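/- Let $M$ be a connected Hausdorff smooth ($C^\infty$) manifold of finite dimension, without boundary, and let $g$ be a semi-Riemannian metric on $M$, that is, a smooth field of symmetric non-degenerate bilinear forms on the tangent spaces of $M$. Let $0<b<\infty$ and let $\gamma:[0,b)\to M$ be a geodesic of $g$, that is, a smooth curve with $\frac{D\gamma'}{ds}=0$ on $[0,b)$, where $\frac{D}{ds}$ is the covariant derivative along $\gamma$ of the Levi-Civita connection of $g$. Then the following statements are equivalent: (i) $\gamma$ is extendible beyond $b$, i.e. there are $b'>b$ and a geodesic $\sigma:[0,b')\to M$ of $g$ with $\sigma|_{[0,b)}=\gamma$; (ii) for some complete smooth Riemannian metric $g_R$ on $M$, the function $|\gamma'|_R=g_R(\gamma',\gamma')^{1/2}$ is bounded on $[0,b)$; (ii') for every complete smooth Riemannian metric $g_R$ on $M$, the function $|\gamma'|_R=g_R(\gamma',\gamma')^{1/2}$ is bounded on $[0,b)$; (iii) there exists a strictly increasing sequence $(s_n)_n$ in $[0,b)$ with $s_n\to b$ such that $(\gamma'(s_n))_n$ converges in the tangent bundle $TM$. Here a Riemannian metric is called complete if its associated distance (the infimum of the lengths of $C^1$ curves)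 is complete. -/

import Mathlib

open scoped Manifold ContDiff Topology ENNReal Bundle

noncomputable section

namespace SemiRiemannian

variable {E : Type*} [NormedAddCommGroup E] [NormedSpace ℝ E]
  {M : Type*} [TopologicalSpace M] [ChartedSpace E M] [IsManifold 𝓘(ℝ, E) ∞ M]

variable (E M) in
/-- A smooth semi-Riemannian metric on `M`: a smooth field of symmetric, non-degenerate bilinear
forms on the tangent spaces. (On a connected manifold its index is automatically constant.) -/
structure Metric where
  /-- The scalar product on each tangent space. -/
  val (x : M) : TangentSpace 𝓘(ℝ, E) x →L[ℝ] TangentSpace 𝓘(ℝ, E) x →L[ℝ] ℝ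
  symm (x : M) (v w : TangentSpace 𝓘(ℝ, E) x) : val x v w = val x w v
  nondegenerate (x : M) (v : TangentSpace 𝓘(ℝ, E) x) (hv : ∀ w, val x v w = 0) : v = 0
  contMDiff : ContMDiff 𝓘(ℝ, E) (𝓘(ℝ, E).prod 𝓘(ℝ, E →L[ℝ] E →L[ℝ] ℝ)) ∞
    (fun x ↦ Bundle.TotalSpace.mk' (E →L[ℝ] E →L[ℝ] ℝ)
      (E := fun x : M ↦ TangentSpace 𝓘(ℝ, E) x →L[ℝ] TangentSpace 𝓘(ℝ, E) x →L[ℝ] ℝ) x (val x))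

/-- The metric `g` read in the chart `φ` at `p`: the pullback of `g` by `φ⁻¹`, a field of bilinear
forms on the (open) image of `φ` in `E`.
(As types, the tangent spaces of `M` are all `E`; `B` and `A` only use this to be composed.) -/
def Metric.inChart (g : Metric E M) (p : M) (y : E) : E →L[ℝ] E →L[ℝ] ℝ :=
  letI B : E →L[ℝ] E →L[ℝ] ℝ := g.val ((extChartAt 𝓘(ℝ, E) p).symm y)
  letI A : E →L[ℝ] E := mfderiv 𝓘(ℝ, E) 𝓘(ℝ, E) (extChartAt 𝓘(ℝ, E) p).symm y
  B.bilinearComp A A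

/-- The Christoffel symbols of the Levi-Civita connection of `g` in the chart at `p`. With `G` the
metric in the chart, `Γ_y(u, v)` is the vector such that for all `w`
`G_y(Γ_y(u, v), w) = 1/2 (DG_y(u)(v, w) + DG_y(v)(u, w) - DG_y(w)(u, v))`. -/
def Metric.christoffel (g : Metric E M) (p : M) (y u v : E) : E :=
  (g.inChart p y).inverse ((1 / 2 : ℝ) •
    (fderiv ℝ (g.inChart p) y u v + fderiv ℝ (g.inChart p) y v u
      - ((fderiv ℝ (g.inChart p) y).flip u).flip v))

/-- The velocity at time `t` of a curve `γ` with domain of definition `s ⊆ ℝ`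
(one-sided at the endpoints of an interval `s` which belong to `s`). -/
def velocity (γ : ℝ → M) (s : Set ℝ) (t : ℝ) : TangentSpace 𝓘(ℝ, E) (γ t) :=
  mfderivWithin 𝓘(ℝ, ℝ) 𝓘(ℝ, E) γ s t (1 : ℝ)

/-- The coordinates, in the chart at `p`, of the acceleration `D γ' / ds` at time `t` of a curve `γ`
with domain of definition `s ⊆ ℝ`: if `u` is `γ` read in the chart, this is `u'' + Γ_u(u', u')`. -/
def Metric.acceleration (g : Metric E M) (p : M) (γ : ℝ → M) (s : Set ℝ) (t : ℝ) : E :=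
  letI u : ℝ → E := fun τ ↦ extChartAt 𝓘(ℝ, E) p (γ τ)
  derivWithin (derivWithin u s) s t
    + g.christoffel p (u t) (derivWithin u s t) (derivWithin u s t)

/-- `γ` restricted to `s` is a geodesic of `g`: it is smooth and its acceleration vanishes
(in all the charts of the manifold). -/
def Metric.IsGeodesicOn (g : Metric E M) (γ : ℝ → M) (s : Set ℝ) : Prop :=
  ContMDiffOn 𝓘(ℝ, ℝ) 𝓘(ℝ, E) ∞ γ s ∧
    ∀ t ∈ s, ∀ p : M, γ t ∈ (extChartAt 𝓘(ℝ, E) p).source → g.acceleration p γ s t = 0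

/-- The geodesic `γ : [0, b) → M` is extendible beyond `b`: it is the restriction of a geodesic
defined on `[0, b')` for some `b' > b`. -/
def Metric.IsExtendibleBeyond (g : Metric E M) (γ : ℝ → M) (b : ℝ) : Prop :=
  ∃ b' > b, ∃ σ : ℝ → M, g.IsGeodesicOn σ (Set.Ico 0 b') ∧ Set.EqOn σ γ (Set.Ico 0 b)

variable (E M) in
/-- Smooth Riemannian metrics on `M`. -/
abbrev RiemMetric : Type _ :=
  Bundle.ContMDiffRiemannianMetric 𝓘(ℝ, E) ∞ E (fun x : M ↦ TangentSpace 𝓘(ℝ, E) x)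

/-- The distance of a Riemannian metric: the infimum of the lengths of `C¹` curves. -/
def riemDist (gR : RiemMetric E M) (x y : M) : ℝ≥0∞ :=
  letI : Bundle.RiemannianBundle (fun x : M ↦ TangentSpace 𝓘(ℝ, E) x) := ⟨gR.toRiemannianMetric⟩
  Manifold.riemannianEDist 𝓘(ℝ, E) x y

/-- A Riemannian metric is complete if its distance is: each Cauchy sequence converges. -/
def IsCompleteMetric (gR : RiemMetric E M) : Prop :=
  ∀ x : ℕ → M, (∀ ε > 0, ∃ N, ∀ m ≥ N, ∀ n ≥ N, riemDist gR (x m) (x n) < ε) →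
    ∃ y : M, Filter.Tendsto (fun n ↦ riemDist gR (x n) y) Filter.atTop (𝓝 0)

/-- The norm `|γ'|_R = g_R(γ', γ')^{1/2}` is bounded along the curve `γ` with domain `s`. -/
def BoundedSpeedOn (gR : RiemMetric E M) (γ : ℝ → M) (s : Set ℝ) : Prop :=
  ∃ C : ℝ, ∀ t ∈ s, √(gR.inner (γ t) (velocity γ s t) (velocity γ s t)) ≤ C

end SemiRiemannian

end

/-!
The geodesic equation is the ODE of a vector field (the geodesic spray) on the tangent bundle. If
the velocities accumulate at some vector as `s → b`, then the Picard–Lindelöf theorem solves the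
equation, with an existence time bounded below, from every initial condition near that vector, so a
solution started late enough reaches beyond `b`, and by uniqueness it extends the geodesic. If the
speed is bounded for a complete Riemannian metric, the positions are Cauchy, hence converge, and the
velocities stay in a compact part of the tangent bundle, so they accumulate.

A complete Riemannian metric exists once `M` is second countable: one dominating `df ⊗ df` for a
proper smooth function `f` is complete, because `f` is then 1-Lipschitz and bounded sets have
compact closure. Second countability is not assumed, but connectedness and the uniqueness of
geodesics force it.
-/

noncomputable section

namespace SemiRiemannian

open Set Filter

set_option maxSynthPendingDepth 3

section LeviCivita

variable {E F : Type*} [NormedAddCommGroup E] [NormedSpace ℝ E]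
  [NormedAddCommGroup F] [NormedSpace ℝ F]

/-- The Christoffel symbols `Γ_y(u, v)` of the Levi-Civita connection of a field `G` of bilinear
forms on a normed space. They are characterised by the Koszul formula `apply_leviCivita` where
`G y` is invertible, and are `0` elsewhere, as `ContinuousLinearMap.inverse` is. -/
def leviCivita (G : E → E →L[ℝ] E →L[ℝ] ℝ) (y u v : E) : E :=
  (G y).inverse ((1 / 2 : ℝ) •
    (fderiv ℝ G y u v + fderiv ℝ G y v u - ((fderiv ℝ G y).flip u).flip v))

lemma apply_leviCivita {G : E → E →L[ℝ] E →L[ℝ] ℝ} {y : E} (hG : (G y).IsInvertible)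
    (u v w : E) :
    G y (leviCivita G y u v) w =
      1 / 2 * (fderiv ℝ G y u v w + fderiv ℝ G y v u w - fderiv ℝ G y w u v) := by
  rw [leviCivita, hG.self_apply_inverse]
  simp

lemma contDiffAt_leviCivita [CompleteSpace E] {G : E → E →L[ℝ] E →L[ℝ] ℝ} {n : WithTop ℕ∞}
    {x : E × E × E} (hG : ContDiffAt ℝ (n + 1) G x.1) (hinv : (G x.1).IsInvertible) :
    ContDiffAt ℝ n (fun x : E × E × E ↦ leviCivita G x.1 x.2.1 x.2.2) x := by
  have hDG : ContDiffAt ℝ n (fun x : E × E × E ↦ fderiv ℝ G x.1) x :=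
    (hG.fderiv_right le_rfl).comp x contDiffAt_fst
  have hu : ContDiffAt ℝ n (fun x : E × E × E ↦ x.2.1) x := by fun_prop
  have hv : ContDiffAt ℝ n (fun x : E × E × E ↦ x.2.2) x := by fun_prop
  have hG_inv : ContDiffAt ℝ n (fun x : E × E × E ↦ (G x.1).inverse) x :=
    ContDiffAt.comp (g := ContinuousLinearMap.inverse) x hinv.contDiffAt_map_inverse
      ((hG.of_le le_self_add).comp x contDiffAt_fst)
  have hsum : ContDiffAt ℝ n (fun x : E × E × E ↦
      fderiv ℝ G x.1 x.2.1 x.2.2 + fderiv ℝ G x.1 x.2.2 x.2.1) x :=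
    ((hDG.clm_apply hu).clm_apply hv).add ((hDG.clm_apply hv).clm_apply hu)
  have hflip : ContDiffAt ℝ n (fun x : E × E × E ↦ ((fderiv ℝ G x.1).flip x.2.1).flip x.2.2) x := by
    have h₁ : ContDiffAt ℝ n (fun x : E × E × E ↦ (fderiv ℝ G x.1).flip) x :=
      (ContinuousLinearMap.flipₗᵢ ℝ E E (E →L[ℝ] ℝ)).contDiff.contDiffAt.comp x hDG
    exact ((ContinuousLinearMap.flipₗᵢ ℝ E E ℝ).contDiff.contDiffAt.comp x
      (h₁.clm_apply hu)).clm_apply hv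
  exact hG_inv.clm_apply ((hsum.sub hflip).const_smul _)

lemma fderiv_eq_of_pullback {G : E → E →L[ℝ] E →L[ℝ] ℝ} {G' : F → F →L[ℝ] F →L[ℝ] ℝ} {ψ : E → F}
    {y : E} (hG : DifferentiableAt ℝ G y) (hG' : DifferentiableAt ℝ G' (ψ y))
    (hψ : ContDiffAt ℝ 2 ψ y)
    (hpull : ∀ᶠ z in 𝓝 y, ∀ u w, G z u w = G' (ψ z) (fderiv ℝ ψ z u) (fderiv ℝ ψ z w))
    (c u w : E) :
    fderiv ℝ G y c u w =
      fderiv ℝ G' (ψ y) (fderiv ℝ ψ y c) (fderiv ℝ ψ y u) (fderiv ℝ ψ y w)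
      + G' (ψ y) (fderiv ℝ (fderiv ℝ ψ) y c u) (fderiv ℝ ψ y w)
      + G' (ψ y) (fderiv ℝ ψ y u) (fderiv ℝ (fderiv ℝ ψ) y c w) := by
  have hDψ (a : E) : HasFDerivAt (fun z ↦ fderiv ℝ ψ z a) ((fderiv ℝ (fderiv ℝ ψ) y).flip a) y := by
    simpa using ((hψ.fderiv_right (m := 1) le_rfl).differentiableAt
      one_ne_zero).hasFDerivAt.clm_apply (hasFDerivAt_const a y)
  have hleft := (hG.hasFDerivAt.clm_apply (hasFDerivAt_const u y)).clm_apply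
    (hasFDerivAt_const w y)
  have hright := ((hG'.hasFDerivAt.comp y
    (hψ.differentiableAt two_ne_zero).hasFDerivAt).clm_apply (hDψ u)).clm_apply (hDψ w)
  have heq := hleft.unique (hright.congr_of_eventuallyEq (hpull.mono fun z hz ↦ hz u w))
  simpa [add_comm, add_left_comm, add_assoc] using DFunLike.congr_fun heq c

lemma fderiv_leviCivita_of_pullback {G : E → E →L[ℝ] E →L[ℝ] ℝ} {G' : F → F →L[ℝ] F →L[ℝ] ℝ}
    {ψ : E → F} {y : E} (hG : DifferentiableAt ℝ G y) (hG' : DifferentiableAt ℝ G' (ψ y))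
    (hψ : ContDiffAt ℝ 2 ψ y)
    (hpull : ∀ᶠ z in 𝓝 y, ∀ u w, G z u w = G' (ψ z) (fderiv ℝ ψ z u) (fderiv ℝ ψ z w))
    (hsymm : ∀ u w, G' (ψ y) u w = G' (ψ y) w u) (hinv : (G y).IsInvertible)
    (hinv' : (G' (ψ y)).IsInvertible) (hsurj : Function.Surjective (fderiv ℝ ψ y)) (u : E) :
    fderiv ℝ ψ y (leviCivita G y u u) =
      leviCivita G' (ψ y) (fderiv ℝ ψ y u) (fderiv ℝ ψ y u) + fderiv ℝ (fderiv ℝ ψ) y u u := by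
  apply hinv'.injective
  ext w'
  obtain ⟨w, rfl⟩ := hsurj w'
  have hsymm₂ : fderiv ℝ (fderiv ℝ ψ) y w u = fderiv ℝ (fderiv ℝ ψ) y u w :=
    hψ.isSymmSndFDerivAt (by simp) w u
  have hderiv := fderiv_eq_of_pullback hG hG' hψ hpull
  rw [← hpull.self_of_nhds, apply_leviCivita hinv, map_add, add_apply, apply_leviCivita hinv',
    hderiv, hderiv, hsymm₂, hsymm (fderiv ℝ ψ y u) (fderiv ℝ (fderiv ℝ ψ) y u w)]
  ring

end LeviCivita

section Charts

variable {E : Type*} [NormedAddCommGroup E] [NormedSpace ℝ E]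
  {M : Type*} [TopologicalSpace M] [ChartedSpace E M]

/-- The change of charts from the chart at `p` to the chart at `q`. -/
def chartChange (p q : M) (y : E) : E := extChartAt 𝓘(ℝ, E) q ((extChartAt 𝓘(ℝ, E) p).symm y)

variable [IsManifold 𝓘(ℝ, E) ∞ M]

lemma contMDiffAt_extChartAt_symm {p : M} {y : E} (hy : y ∈ (extChartAt 𝓘(ℝ, E) p).target) :
    ContMDiffAt 𝓘(ℝ, E) 𝓘(ℝ, E) ∞ (extChartAt 𝓘(ℝ, E) p).symm y :=
  (contMDiffOn_extChartAt_symm p).contMDiffAt (extChartAt_target_mem_nhds' hy)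

lemma contMDiffAt_extChartAt_of_mem_source {p x : M} (hx : x ∈ (extChartAt 𝓘(ℝ, E) p).source) :
    ContMDiffAt 𝓘(ℝ, E) 𝓘(ℝ, E) ∞ (extChartAt 𝓘(ℝ, E) p) x :=
  contMDiffAt_extChartAt' (by rwa [extChartAt_source] at hx)

lemma exists_equiv_apply_eq_mfderiv_extChartAt_symm {p : M} {y : E}
    (hy : y ∈ (extChartAt 𝓘(ℝ, E) p).target) :
    ∃ A : E ≃L[ℝ] E, ∀ u : E,
      (mfderiv 𝓘(ℝ, E) 𝓘(ℝ, E) (extChartAt 𝓘(ℝ, E) p).symm y u : E) = A u := by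
  obtain ⟨A, hA⟩ := isInvertible_mfderivWithin_extChartAt_symm (I := 𝓘(ℝ, E)) hy
  rw [ModelWithCorners.range_eq_univ, mfderivWithin_univ] at hA
  exact ⟨A, fun u ↦ by rw [← hA]; rfl⟩

lemma contMDiffAt_mfderiv_extChartAt_symm_apply {p : M} {y : E}
    (hy : y ∈ (extChartAt 𝓘(ℝ, E) p).target) (u : E) :
    ContMDiffAt 𝓘(ℝ, E) (𝓘(ℝ, E).prod 𝓘(ℝ, E)) ∞
      (fun y ↦ (⟨(extChartAt 𝓘(ℝ, E) p).symm y,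
        mfderiv 𝓘(ℝ, E) 𝓘(ℝ, E) (extChartAt 𝓘(ℝ, E) p).symm y u⟩ : TangentBundle 𝓘(ℝ, E) M)) y := by
  have hmap := (contMDiffOn_extChartAt_symm (I := 𝓘(ℝ, E)) (n := ∞) p).contMDiffOn_tangentMapWithin
    (m := ∞) (by simp) (isOpen_extChartAt_target p).uniqueMDiffOn
  have hconst : ContMDiffAt 𝓘(ℝ, E) (𝓘(ℝ, E).prod 𝓘(ℝ, E)) ∞
      (fun y ↦ (⟨y, u⟩ : TangentBundle 𝓘(ℝ, E) E)) y :=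
    contMDiffAt_vectorSpace_iff_contDiffAt.2 contDiffAt_const
  have hcomp := (hmap (⟨y, u⟩ : TangentBundle 𝓘(ℝ, E) E) hy).comp_of_eq
    (f := fun y ↦ (⟨y, u⟩ : TangentBundle 𝓘(ℝ, E) E)) hconst.contMDiffWithinAt
    (s := (extChartAt 𝓘(ℝ, E) p).target) (fun z hz ↦ hz) rfl
  refine (hcomp.contMDiffAt (extChartAt_target_mem_nhds' hy)).congr_of_eventuallyEq ?_
  filter_upwards [extChartAt_target_mem_nhds' hy] with z hz
  simp only [Function.comp, tangentMapWithin,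
    mfderivWithin_of_mem_nhds (extChartAt_target_mem_nhds' hz)]

variable {p q : M} {y : E}

lemma contDiffAt_chartChange (hy : y ∈ (extChartAt 𝓘(ℝ, E) p).target)
    (hq : (extChartAt 𝓘(ℝ, E) p).symm y ∈ (extChartAt 𝓘(ℝ, E) q).source) :
    ContDiffAt ℝ ∞ (chartChange (E := E) p q) y :=
  ((contMDiffAt_extChartAt_of_mem_source hq).comp y (contMDiffAt_extChartAt_symm hy)).contDiffAt

lemma eventually_mem_target_and_symm_mem_source (hy : y ∈ (extChartAt 𝓘(ℝ, E) p).target)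
    (hq : (extChartAt 𝓘(ℝ, E) p).symm y ∈ (extChartAt 𝓘(ℝ, E) q).source) :
    ∀ᶠ z in 𝓝 y, z ∈ (extChartAt 𝓘(ℝ, E) p).target ∧
      (extChartAt 𝓘(ℝ, E) p).symm z ∈ (extChartAt 𝓘(ℝ, E) q).source :=
  (eventually_mem_set.2 (extChartAt_target_mem_nhds' hy)).and
    ((contMDiffAt_extChartAt_symm hy).continuousAt.eventually_mem (extChartAt_source_mem_nhds' hq))

lemma mfderiv_extChartAt_symm_eq_comp_fderiv_chartChange
    (hy : y ∈ (extChartAt 𝓘(ℝ, E) p).target)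
    (hq : (extChartAt 𝓘(ℝ, E) p).symm y ∈ (extChartAt 𝓘(ℝ, E) q).source) (u : E) :
    (mfderiv 𝓘(ℝ, E) 𝓘(ℝ, E) (extChartAt 𝓘(ℝ, E) p).symm y u : E) =
      (mfderiv 𝓘(ℝ, E) 𝓘(ℝ, E) (extChartAt 𝓘(ℝ, E) q).symm (chartChange p q y)
        (fderiv ℝ (chartChange p q) y u) : E) := by
  have heq : (extChartAt 𝓘(ℝ, E) p).symm =ᶠ[𝓝 y]
      (extChartAt 𝓘(ℝ, E) q).symm ∘ chartChange p q := by
    filter_upwards [eventually_mem_target_and_symm_mem_source hy hq] with z hz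
    exact ((extChartAt 𝓘(ℝ, E) q).left_inv hz.2).symm
  have hsymm := contMDiffAt_extChartAt_symm ((extChartAt 𝓘(ℝ, E) q).map_source hq)
  have hcomp := mfderiv_comp_apply y (hsymm.mdifferentiableAt (by simp))
    ((contDiffAt_chartChange hy hq).differentiableAt (by simp)).mdifferentiableAt u
  rw [heq.mfderiv_eq, ← mfderiv_eq_fderiv]
  exact hcomp

lemma surjective_fderiv_chartChange (hy : y ∈ (extChartAt 𝓘(ℝ, E) p).target)
    (hq : (extChartAt 𝓘(ℝ, E) p).symm y ∈ (extChartAt 𝓘(ℝ, E) q).source) :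
    Function.Surjective (fderiv ℝ (chartChange (E := E) p q) y) := by
  obtain ⟨A, hA⟩ := exists_equiv_apply_eq_mfderiv_extChartAt_symm hy
  obtain ⟨A', hA'⟩ := exists_equiv_apply_eq_mfderiv_extChartAt_symm
    ((extChartAt 𝓘(ℝ, E) q).map_source hq)
  have hcomp (u : E) : A u = A' (fderiv ℝ (chartChange p q) y u) := by
    rw [← hA, ← hA']
    exact mfderiv_extChartAt_symm_eq_comp_fderiv_chartChange hy hq u
  exact fun w ↦ ⟨A.symm (A' w), A'.injective (by rw [← hcomp, A.apply_symm_apply])⟩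

end Charts

section MetricInChart

variable {E : Type*} [NormedAddCommGroup E] [NormedSpace ℝ E]
  {M : Type*} [TopologicalSpace M] [ChartedSpace E M] [IsManifold 𝓘(ℝ, E) ∞ M]
  (g : Metric E M) {p q : M} {y : E}

/-- The geodesic spray in the chart at `p`: the vector field on `E × E` whose integral curves are
the pairs `(u, u')` with `u'' + Γ_u(u', u') = 0`. -/
def Metric.spray (p : M) (z : E × E) : E × E := (z.2, -g.christoffel p z.1 z.2 z.2)

lemma Metric.spray_zero (p : M) (y : E) : g.spray p (y, 0) = 0 := by
  simp [spray, christoffel]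

lemma Metric.inChart_apply (p : M) (y u w : E) :
    g.inChart p y u w = g.val ((extChartAt 𝓘(ℝ, E) p).symm y)
      (mfderiv 𝓘(ℝ, E) 𝓘(ℝ, E) (extChartAt 𝓘(ℝ, E) p).symm y u)
      (mfderiv 𝓘(ℝ, E) 𝓘(ℝ, E) (extChartAt 𝓘(ℝ, E) p).symm y w) := rfl

lemma Metric.inChart_symm (p : M) (y u w : E) : g.inChart p y u w = g.inChart p y w u := by
  rw [inChart_apply, inChart_apply, g.symm]

lemma Metric.inChart_eq_pullback_chartChange (hy : y ∈ (extChartAt 𝓘(ℝ, E) p).target)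
    (hq : (extChartAt 𝓘(ℝ, E) p).symm y ∈ (extChartAt 𝓘(ℝ, E) q).source) (u w : E) :
    g.inChart p y u w = g.inChart q (chartChange p q y)
      (fderiv ℝ (chartChange p q) y u) (fderiv ℝ (chartChange p q) y w) := by
  have hx : (extChartAt 𝓘(ℝ, E) q).symm (chartChange p q y) = (extChartAt 𝓘(ℝ, E) p).symm y :=
    (extChartAt 𝓘(ℝ, E) q).left_inv hq
  have hval {x x' : M} (hx : x' = x) (a b : E) :
      (g.val x : E →L[ℝ] E →L[ℝ] ℝ) a b = (g.val x' : E →L[ℝ] E →L[ℝ] ℝ) a b := by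
    rw [hx]
  calc g.inChart p y u w
    _ = (g.val ((extChartAt 𝓘(ℝ, E) p).symm y) : E →L[ℝ] E →L[ℝ] ℝ)
        (mfderiv 𝓘(ℝ, E) 𝓘(ℝ, E) (extChartAt 𝓘(ℝ, E) q).symm (chartChange p q y)
          (fderiv ℝ (chartChange p q) y u))
        (mfderiv 𝓘(ℝ, E) 𝓘(ℝ, E) (extChartAt 𝓘(ℝ, E) q).symm (chartChange p q y)
          (fderiv ℝ (chartChange p q) y w)) :=
      congrArg₂ (fun a b : E ↦ (g.val _ : E →L[ℝ] E →L[ℝ] ℝ) a b)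
        (mfderiv_extChartAt_symm_eq_comp_fderiv_chartChange hy hq u)
        (mfderiv_extChartAt_symm_eq_comp_fderiv_chartChange hy hq w)
    _ = _ := hval hx _ _

variable [FiniteDimensional ℝ E]

lemma Metric.contDiffOn_inChart (p : M) :
    ContDiffOn ℝ ∞ (g.inChart p) (extChartAt 𝓘(ℝ, E) p).target := by
  refine contDiffOn_clm_apply.2 fun u ↦ contDiffOn_clm_apply.2 fun w y hy ↦ ?_
  have hg := (g.contMDiff.contMDiffAt (x := (extChartAt 𝓘(ℝ, E) p).symm y)).comp y
    (contMDiffAt_extChartAt_symm hy)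
  have happly := ContMDiffAt.clm_bundle_apply₂ (F₁ := E) (F₂ := E) (F₃ := ℝ)
    (E₁ := fun x : M ↦ TangentSpace 𝓘(ℝ, E) x) (E₂ := fun x : M ↦ TangentSpace 𝓘(ℝ, E) x)
    (E₃ := fun _ ↦ ℝ) hg (contMDiffAt_mfderiv_extChartAt_symm_apply hy u)
    (contMDiffAt_mfderiv_extChartAt_symm_apply hy w)
  exact (Bundle.contMDiffAt_totalSpace.1 happly).2.contDiffAt.contDiffWithinAt

lemma Metric.contDiffAt_inChart (hy : y ∈ (extChartAt 𝓘(ℝ, E) p).target) :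
    ContDiffAt ℝ ∞ (g.inChart p) y :=
  (g.contDiffOn_inChart p).contDiffAt (extChartAt_target_mem_nhds' hy)

lemma Metric.isInvertible_inChart (hy : y ∈ (extChartAt 𝓘(ℝ, E) p).target) :
    (g.inChart p y).IsInvertible := by
  obtain ⟨A, hA⟩ := exists_equiv_apply_eq_mfderiv_extChartAt_symm hy
  have hinj : Function.Injective (g.inChart p y) := by
    refine (injective_iff_map_eq_zero _).2 fun v hv ↦ A.map_eq_zero_iff.1 ?_
    refine g.nondegenerate ((extChartAt 𝓘(ℝ, E) p).symm y) (A v) fun w ↦ ?_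
    have hvw : g.inChart p y v (A.symm w) = 0 := by rw [hv]; rfl
    rw [inChart_apply, hA, hA] at hvw
    exact (congrArg _ (A.apply_symm_apply w)).symm.trans hvw
  have hrank : Module.finrank ℝ E = Module.finrank ℝ (E →L[ℝ] ℝ) := by
    rw [← (LinearMap.toContinuousLinearMap (𝕜 := ℝ) (E := E) (F' := ℝ)).finrank_eq]
    simp
  exact ⟨(LinearEquiv.ofInjectiveOfFinrankEq (g.inChart p y).toLinearMap hinj
    hrank).toContinuousLinearEquiv, by ext; rfl⟩

lemma Metric.fderiv_chartChange_christoffel (hy : y ∈ (extChartAt 𝓘(ℝ, E) p).target)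
    (hq : (extChartAt 𝓘(ℝ, E) p).symm y ∈ (extChartAt 𝓘(ℝ, E) q).source) (u : E) :
    fderiv ℝ (chartChange (E := E) p q) y (g.christoffel p y u u) =
      g.christoffel q (chartChange p q y) (fderiv ℝ (chartChange (E := E) p q) y u)
        (fderiv ℝ (chartChange (E := E) p q) y u)
      + fderiv ℝ (fderiv ℝ (chartChange (E := E) p q)) y u u := by
  have hqy : chartChange p q y ∈ (extChartAt 𝓘(ℝ, E) q).target :=
    (extChartAt 𝓘(ℝ, E) q).map_source hq
  refine fderiv_leviCivita_of_pullback ((g.contDiffAt_inChart hy).differentiableAt (by simp))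
    ((g.contDiffAt_inChart hqy).differentiableAt (by simp))
    ((contDiffAt_chartChange hy hq).of_le (WithTop.coe_le_coe.2 le_top)) ?_ (g.inChart_symm q _)
    (g.isInvertible_inChart hy) (g.isInvertible_inChart hqy) (surjective_fderiv_chartChange hy hq) u
  filter_upwards [eventually_mem_target_and_symm_mem_source hy hq] with z hz
  exact g.inChart_eq_pullback_chartChange hz.1 hz.2

lemma Metric.contDiffAt_spray {z : E × E} (hz : z.1 ∈ (extChartAt 𝓘(ℝ, E) p).target) :
    ContDiffAt ℝ ∞ (g.spray p) z := by
  have hΓ : ContDiffAt ℝ ∞ (fun x : E × E × E ↦ g.christoffel p x.1 x.2.1 x.2.2) (z.1, z.2, z.2) :=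
    contDiffAt_leviCivita (n := ∞) (g.contDiffAt_inChart hz) (g.isInvertible_inChart hz)
  exact contDiffAt_snd.prodMk (hΓ.comp (f := fun z : E × E ↦ (z.1, z.2, z.2)) z (by fun_prop)).neg

end MetricInChart

section Flow

variable {V : Type*} [NormedAddCommGroup V] [NormedSpace ℝ V]

lemma eqOn_const_of_hasDerivAt_ode {F : V → V} {x₀ : V} {z : ℝ → V} {U : Set V} {K : NNReal}
    {ε : ℝ} (hF : LipschitzOnWith K F U) (hx₀ : x₀ ∈ U) (hF₀ : F x₀ = 0) (hε : 0 < ε)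
    (hz : ∀ t ∈ Ioo (-ε) ε, HasDerivAt z (F (z t)) t ∧ z t ∈ U) (hz₀ : z 0 = x₀) :
    EqOn z (fun _ ↦ x₀) (Ioo (-ε) ε) :=
  ODE_solution_unique_of_mem_Ioo (v := fun _ ↦ F) (fun _ _ ↦ hF) ⟨neg_lt_zero.2 hε, hε⟩ hz
    (fun t _ ↦ ⟨by simpa only [hF₀] using hasDerivAt_const t x₀, hx₀⟩) hz₀

variable [CompleteSpace V]

lemma exists_local_flow {F : V → V} {x₀ : V} (hF : ContDiffAt ℝ 1 F x₀) {U : Set V}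
    (hU : U ∈ 𝓝 x₀) :
    ∃ ε > 0, ∃ α : V → ℝ → V, ∃ L : NNReal,
      (∀ x ∈ Metric.closedBall x₀ ε, α x 0 = x ∧
        ∀ t ∈ Icc (-ε) ε, HasDerivAt (α x) (F (α x t)) t ∧ α x t ∈ U) ∧
      ∀ t ∈ Icc (-ε) ε, LipschitzOnWith L (α · t) (Metric.closedBall x₀ ε) := by
  obtain ⟨ε, hε, a, r, L, K, hr, hpl⟩ := IsPicardLindelof.of_contDiffAt_one hF
  obtain ⟨α, hα, L', hL'⟩ :=
    (hpl 0).exists_forall_mem_closedBall_eq_hasDerivWithinAt_lipschitzOnWith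
  simp only [zero_sub, zero_add] at hα hL'
  have hcont : ContinuousOn (Function.uncurry α) (Metric.closedBall x₀ r ×ˢ Icc (-ε) ε) :=
    continuousOn_prod_of_continuousOn_lipschitzOnWith _ L'
      (fun x hx ↦ HasDerivWithinAt.continuousOn (hα x hx).2) hL'
  have hball : Metric.closedBall x₀ (r : ℝ) ∈ 𝓝 x₀ := Metric.closedBall_mem_nhds _ hr
  have hIcc : Icc (-ε) ε ∈ 𝓝 0 := Icc_mem_nhds (by linarith) hε
  have hU₀ : Function.uncurry α ⁻¹' U ∈ 𝓝 (x₀, (0 : ℝ)) := by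
    refine (hcont.continuousAt (prod_mem_nhds hball hIcc)).preimage_mem_nhds ?_
    rwa [Function.uncurry_apply_pair, (hα x₀ (mem_of_mem_nhds hball)).1]
  obtain ⟨δ, hδ, hsub⟩ := Metric.nhds_basis_closedBall.mem_iff.1
    (inter_mem (prod_mem_nhds hball (Ioo_mem_nhds (neg_lt_zero.2 hε) hε)) hU₀)
  rw [← closedBall_prod_same, Real.closedBall_eq_Icc, zero_sub, zero_add] at hsub
  have hmem {x : V} (hx : x ∈ Metric.closedBall x₀ δ) {t : ℝ} (ht : t ∈ Icc (-δ) δ) :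
      (x ∈ Metric.closedBall x₀ (r : ℝ) ∧ t ∈ Ioo (-ε) ε) ∧ α x t ∈ U := hsub (a := (x, t)) ⟨hx, ht⟩
  have h0 : (0 : ℝ) ∈ Icc (-δ) δ := ⟨by linarith, hδ.le⟩
  refine ⟨δ, hδ, α, L', fun x hx ↦ ⟨(hα x (hmem hx h0).1.1).1, fun t ht ↦ ⟨?_, (hmem hx ht).2⟩⟩,
    fun t ht ↦ ?_⟩
  · obtain ⟨hx', ht'⟩ := (hmem hx ht).1
    exact ((hα x hx').2 t (Ioo_subset_Icc_self ht')).hasDerivAt (Icc_mem_nhds ht'.1 ht'.2)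
  · have hx₀ := Metric.mem_closedBall_self (x := x₀) hδ.le
    exact (hL' t (Ioo_subset_Icc_self (hmem hx₀ ht).1.2)).mono fun x hx ↦ (hmem hx h0).1.1

lemma contDiffAt_of_hasDerivAt_ode {F : V → V} {z : ℝ → V} {t : ℝ} {U : Set V}
    (hF : ContDiffOn ℝ ∞ F U) (hz : ∀ᶠ τ in 𝓝 t, HasDerivAt z (F (z τ)) τ ∧ z τ ∈ U) :
    ContDiffAt ℝ ∞ z t := by
  obtain ⟨ε, hε, hsub⟩ := Metric.nhds_basis_closedBall.mem_iff.1 hz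
  rw [Real.closedBall_eq_Icc] at hsub
  have hcont : ContDiffOn ℝ ∞ z (Icc (t - ε) (t + ε)) :=
    ODE.contDiffOn_enat_Icc_of_hasDerivWithinAt (n := ⊤) (f := fun _ ↦ F) (u := U)
      (hF.comp contDiffOn_snd fun _ hx ↦ hx.2)
      (fun τ hτ ↦ (hsub hτ).1.hasDerivWithinAt) (fun τ hτ ↦ (hsub hτ).2)
  exact hcont.contDiffAt (Icc_mem_nhds (by linarith) (by linarith))

end Flow

section SecondOrder

variable {E : Type*} [NormedAddCommGroup E] [NormedSpace ℝ E]

lemma norm_sub_sub_smul_le_of_hasDerivAt {u v a : ℝ → E} {C s : ℝ}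
    (hu : ∀ t ∈ uIcc 0 s, HasDerivAt u (v t) t) (hv : ∀ t ∈ uIcc 0 s, HasDerivAt v (a t) t)
    (ha : ∀ t ∈ uIcc 0 s, ‖a t‖ ≤ C) : ‖u s - u 0 - s • v 0‖ ≤ C * |s| * |s| := by
  have hC : 0 ≤ C := (norm_nonneg _).trans (ha 0 left_mem_uIcc)
  have hv' (t : ℝ) (ht : t ∈ uIcc 0 s) : ‖v t - v 0‖ ≤ C * |s| :=
    calc ‖v t - v 0‖
      _ ≤ C * ‖t - 0‖ := (convex_uIcc 0 s).norm_image_sub_le_of_norm_hasDerivWithin_le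
        (fun τ hτ ↦ (hv τ hτ).hasDerivWithinAt) ha left_mem_uIcc ht
      _ ≤ C * |s| := by
        gcongr
        simpa using abs_sub_left_of_mem_uIcc ht
  have hw (t : ℝ) (ht : t ∈ uIcc 0 s) : HasDerivAt (fun t ↦ u t - t • v 0) (v t - v 0) t := by
    simpa using (hu t ht).fun_sub ((hasDerivAt_id t).smul_const (v 0))
  simpa [sub_right_comm] using (convex_uIcc 0 s).norm_image_sub_le_of_norm_hasDerivWithin_le
    (fun τ hτ ↦ (hw τ hτ).hasDerivWithinAt) hv' left_mem_uIcc right_mem_uIcc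

lemma approximatesLinearOn_fst_of_hasDerivAt {f : E × E → E} {α : E → ℝ → E × E} {y : E}
    {B : Set E} {U : Set (E × E)} {K L : NNReal} {s : ℝ} (hf : LipschitzOnWith K f U)
    (hα₀ : ∀ v ∈ B, α v 0 = (y, v))
    (hα : ∀ v ∈ B, ∀ t ∈ uIcc 0 s, HasDerivAt (α v) ((α v t).2, f (α v t)) t ∧ α v t ∈ U)
    (hL : ∀ t ∈ uIcc 0 s, LipschitzOnWith L (α · t) B) :
    ApproximatesLinearOn (fun v ↦ (α v s).1) (s • ContinuousLinearMap.id ℝ E) B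
      (K * L * ‖s‖₊ * ‖s‖₊) := by
  intro v hv w hw
  have hfst (v : E) (hv : v ∈ B) (t : ℝ) (ht : t ∈ uIcc 0 s) :
      HasDerivAt (fun t ↦ (α v t).1) (α v t).2 t :=
    (hasFDerivAt_fst (𝕜 := ℝ) (p := α v t)).comp_hasDerivAt t (hα v hv t ht).1
  have hsnd (v : E) (hv : v ∈ B) (t : ℝ) (ht : t ∈ uIcc 0 s) :
      HasDerivAt (fun t ↦ (α v t).2) (f (α v t)) t :=
    (hasFDerivAt_snd (𝕜 := ℝ) (p := α v t)).comp_hasDerivAt t (hα v hv t ht).1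
  have hbound (t : ℝ) (ht : t ∈ uIcc 0 s) :
      ‖f (α v t) - f (α w t)‖ ≤ K * (L * ‖v - w‖) :=
    (hf.norm_sub_le (hα v hv t ht).2 (hα w hw t ht).2).trans
      (by gcongr; exact (hL t ht).norm_sub_le hv hw)
  have htaylor := norm_sub_sub_smul_le_of_hasDerivAt
    (fun t ht ↦ (hfst v hv t ht).sub (hfst w hw t ht))
    (fun t ht ↦ (hsnd v hv t ht).sub (hsnd w hw t ht)) hbound
  simp only [Pi.sub_apply, hα₀ v hv, hα₀ w hw, sub_self, sub_zero] at htaylor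
  refine htaylor.trans_eq ?_
  simp only [NNReal.coe_mul, coe_nnnorm, Real.norm_eq_abs]
  ring

variable [CompleteSpace E]

lemma image_mem_nhds_of_approximatesLinearOn_smul_id {f : E → E} {s : ℝ} {B : Set E} {c : NNReal}
    {x : E} (hf : ApproximatesLinearOn f (s • ContinuousLinearMap.id ℝ E) B c) (hs : s ≠ 0)
    (hc : c < ‖s‖₊) (hB : B ∈ 𝓝 x) : f '' B ∈ 𝓝 (f x) := by
  let R : (s • ContinuousLinearMap.id ℝ E).NonlinearRightInverse :=
    { toFun := fun y ↦ s⁻¹ • y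
      nnnorm := ‖s‖₊⁻¹
      bound' := fun y ↦ by simp [norm_smul]
      right_inv' := fun y ↦ by simp [smul_smul, hs] }
  exact hf.image_mem_nhds R hB (.inr (by rwa [inv_inv]))

/-- For a second order equation with the equilibrium `(y₀, 0)`, the position at a small time `s` is
approximately `y₀ + s v` as a function of the initial velocity `v`, hence is onto a neighborhood
of `y₀`. -/
lemma exists_solution_through {f : E × E → E} {y₀ : E} (hf : ContDiffAt ℝ 1 f (y₀, 0))
    (hf₀ : f (y₀, 0) = 0) {U : Set (E × E)} (hU : U ∈ 𝓝 (y₀, (0 : E))) :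
    ∃ ε > 0, ∀ s : ℝ, s ≠ 0 → |s| < ε → ∀ᶠ y in 𝓝 y₀, ∃ z : ℝ → E × E,
      (∀ t ∈ Icc (-ε) ε, HasDerivAt z ((z t).2, f (z t)) t ∧ z t ∈ U) ∧
      (z 0).1 = y₀ ∧ (z s).1 = y := by
  have hF : ContDiffAt ℝ 1 (fun z : E × E ↦ (z.2, f z)) (y₀, 0) := contDiffAt_snd.prodMk hf
  obtain ⟨K, U', hU', hK⟩ := hF.exists_lipschitzOnWith
  obtain ⟨ε, hε, α, L, hα, hL⟩ := exists_local_flow hF (inter_mem hU hU')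
  have hB {v : E} (hv : v ∈ Metric.closedBall (0 : E) ε) :
      (y₀, v) ∈ Metric.closedBall (y₀, (0 : E)) ε := by
    simpa [Prod.dist_eq, hε.le] using hv
  have hconst : EqOn (α (y₀, 0)) (fun _ ↦ (y₀, 0)) (Ioo (-ε) ε) := by
    obtain ⟨hα₀, hα'⟩ := hα _ (hB (Metric.mem_closedBall_self hε.le))
    exact eqOn_const_of_hasDerivAt_ode hK (mem_of_mem_nhds hU') (Prod.ext rfl hf₀) hε
      (fun t ht ↦ (hα' t (Ioo_subset_Icc_self ht)).imp_right And.right) hα₀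
  have hKL : 0 < (K : ℝ) * L + 1 := by positivity
  refine ⟨min ε (1 / (K * L + 1)), by positivity, fun s hs hsε ↦ ?_⟩
  obtain ⟨hsε, hsKL⟩ := lt_min_iff.1 hsε
  have hsub : uIcc 0 s ⊆ Icc (-ε) ε := uIcc_subset_Icc ⟨by linarith, hε.le⟩ (abs_le.1 hsε.le)
  have happrox : ApproximatesLinearOn (fun v ↦ (α (y₀, v) s).1) (s • ContinuousLinearMap.id ℝ E)
      (Metric.closedBall 0 ε) (1 * K * (L * 1) * ‖s‖₊ * ‖s‖₊) :=
    approximatesLinearOn_fst_of_hasDerivAt (LipschitzWith.prod_snd.comp_lipschitzOnWith hK)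
      (fun v hv ↦ (hα _ (hB hv)).1)
      (fun v hv t ht ↦ ((hα _ (hB hv)).2 t (hsub ht)).imp_right And.right)
      fun t ht ↦ (hL t (hsub ht)).comp (LipschitzWith.prodMk_left y₀).lipschitzOnWith fun _ ↦ hB
  have hlt : 1 * K * (L * 1) * ‖s‖₊ * ‖s‖₊ < ‖s‖₊ := by
    have hpos : 0 < |s| := abs_pos.2 hs
    rw [lt_div_iff₀' hKL] at hsKL
    rw [← NNReal.coe_lt_coe]
    simp only [NNReal.coe_mul, NNReal.coe_one, coe_nnnorm, Real.norm_eq_abs]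
    nlinarith
  have himage := image_mem_nhds_of_approximatesLinearOn_smul_id happrox hs hlt
    (Metric.closedBall_mem_nhds 0 hε)
  rw [hconst (abs_lt.1 hsε)] at himage
  filter_upwards [himage]
  rintro _ ⟨v, hv, rfl⟩
  refine ⟨α (y₀, v), fun t ht ↦ ?_, by rw [(hα _ (hB hv)).1], rfl⟩
  refine ((hα _ (hB hv)).2 t ?_).imp_right And.left
  exact Icc_subset_Icc (neg_le_neg (min_le_left _ _)) (min_le_left _ _) ht

end SecondOrder

section SecondDerivative

variable {E F : Type*} [NormedAddCommGroup E] [NormedSpace ℝ E]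
  [NormedAddCommGroup F] [NormedSpace ℝ F]

lemma contDiffAt_deriv {u : ℝ → E} {t : ℝ} {n : WithTop ℕ∞} (hu : ContDiffAt ℝ (n + 1) u t) :
    ContDiffAt ℝ n (deriv u) t :=
  (hu.fderiv_right le_rfl).clm_apply contDiffAt_const

lemma eventually_deriv_comp_eq {ψ : E → F} {u : ℝ → E} {t : ℝ} (hψ : ContDiffAt ℝ 1 ψ (u t))
    (hu : ContDiffAt ℝ 1 u t) : deriv (ψ ∘ u) =ᶠ[𝓝 t] fun τ ↦ fderiv ℝ ψ (u τ) (deriv u τ) := by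
  filter_upwards [hu.continuousAt.eventually (hψ.eventually (by simp)), hu.eventually (by simp)]
    with τ hψτ huτ
  exact fderiv_comp_deriv τ (hψτ.differentiableAt one_ne_zero) (huτ.differentiableAt one_ne_zero)

lemma deriv_deriv_comp {ψ : E → F} {u : ℝ → E} {t : ℝ} (hψ : ContDiffAt ℝ 2 ψ (u t))
    (hu : ContDiffAt ℝ 2 u t) :
    deriv (deriv (ψ ∘ u)) t =
      fderiv ℝ (fderiv ℝ ψ) (u t) (deriv u t) (deriv u t)
        + fderiv ℝ ψ (u t) (deriv (deriv u) t) := by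
  rw [(eventually_deriv_comp_eq (hψ.of_le one_le_two) (hu.of_le one_le_two)).deriv_eq]
  have hDψ : HasDerivAt (fun τ ↦ fderiv ℝ ψ (u τ)) (fderiv ℝ (fderiv ℝ ψ) (u t) (deriv u t)) t :=
    ((hψ.fderiv_right (m := 1) le_rfl).differentiableAt
      one_ne_zero).hasFDerivAt.comp_hasDerivAt t (hu.differentiableAt two_ne_zero).hasDerivAt
  exact (hDψ.clm_apply
    ((contDiffAt_deriv (n := 1) hu).differentiableAt one_ne_zero).hasDerivAt).deriv

lemma eventuallyEq_derivWithin {u v : ℝ → E} {s s' : Set ℝ} {t : ℝ} (hu : u =ᶠ[𝓝 t] v)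
    (hs : s =ᶠ[𝓝 t] s') : derivWithin u s =ᶠ[𝓝 t] derivWithin v s' := by
  filter_upwards [hu.eventuallyEq_nhds, hs.eventuallyEq_nhds] with τ huτ hsτ
  rw [derivWithin_congr_set hsτ]
  exact (huτ.filter_mono nhdsWithin_le_nhds).derivWithin_eq huτ.self_of_nhds

end SecondDerivative

section Lift

variable {E : Type*} [NormedAddCommGroup E] [NormedSpace ℝ E]
  {M : Type*} [TopologicalSpace M] [ChartedSpace E M]

/-- The position and the velocity of the curve `γ` at time `t`, read in the chart at `p`. -/
def chartLift (p : M) (γ : ℝ → M) (t : ℝ) : E × E :=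
  (extChartAt 𝓘(ℝ, E) p (γ t), deriv (extChartAt 𝓘(ℝ, E) p ∘ γ) t)

variable {γ γ' : ℝ → M} {t : ℝ} {p : M}

lemma chartLift_congr (h : γ =ᶠ[𝓝 t] γ') (p : M) :
    chartLift (E := E) p γ t = chartLift p γ' t := by
  rw [chartLift, chartLift, h.eq_of_nhds, (h.fun_comp (extChartAt 𝓘(ℝ, E) p)).deriv_eq]

variable [IsManifold 𝓘(ℝ, E) ∞ M]

lemma contDiffAt_extChartAt_comp (hγ : ContMDiffAt 𝓘(ℝ, ℝ) 𝓘(ℝ, E) ∞ γ t)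
    (hp : γ t ∈ (extChartAt 𝓘(ℝ, E) p).source) :
    ContDiffAt ℝ ∞ (extChartAt 𝓘(ℝ, E) p ∘ γ) t :=
  ((contMDiffAt_extChartAt_of_mem_source hp).comp t hγ).contDiffAt

lemma contDiffAt_chartLift (hγ : ContMDiffAt 𝓘(ℝ, ℝ) 𝓘(ℝ, E) ∞ γ t)
    (hp : γ t ∈ (extChartAt 𝓘(ℝ, E) p).source) : ContDiffAt ℝ ∞ (chartLift (E := E) p γ) t :=
  (contDiffAt_extChartAt_comp hγ hp).prodMk (contDiffAt_deriv (contDiffAt_extChartAt_comp hγ hp))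

/-- The coordinates of a tangent vector in the chart of the tangent bundle over the chart at `p`:
the position and the components of the vector. -/
def tangentChart (p : M) (v : TangentBundle 𝓘(ℝ, E) M) : E × E :=
  (extChartAt 𝓘(ℝ, E) p v.1, (trivializationAt E (TangentSpace 𝓘(ℝ, E)) p v).2)

lemma continuousAt_tangentChart {v : TangentBundle 𝓘(ℝ, E) M}
    (hv : v.1 ∈ (extChartAt 𝓘(ℝ, E) p).source) : ContinuousAt (tangentChart p) v := by
  have hproj : ContinuousAt (Bundle.TotalSpace.proj : TangentBundle 𝓘(ℝ, E) M → M) v :=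
    (FiberBundle.continuous_proj E _).continuousAt
  have hbase : v.1 ∈ (trivializationAt E (TangentSpace 𝓘(ℝ, E) (M := M)) p).baseSet := by
    simpa using hv
  exact ((continuousAt_extChartAt' (by simpa using hv)).comp hproj).prodMk
    (((trivializationAt E (TangentSpace 𝓘(ℝ, E)) p).continuousAt (by
      simpa [Bundle.Trivialization.mem_source] using hbase)).snd)

lemma chartLift_eq_tangentChart_velocity {s : Set ℝ} (hs : s ∈ 𝓝 t)
    (hγ : MDifferentiableAt 𝓘(ℝ, ℝ) 𝓘(ℝ, E) γ t) (hp : γ t ∈ (extChartAt 𝓘(ℝ, E) p).source) :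
    chartLift (E := E) p γ t = tangentChart p ⟨γ t, velocity γ s t⟩ := by
  have hp' : γ t ∈ (chartAt E p).source := by simpa using hp
  have hφ : MDifferentiableAt 𝓘(ℝ, E) 𝓘(ℝ, E) (extChartAt 𝓘(ℝ, E) p) (γ t) :=
    (contMDiffAt_extChartAt_of_mem_source hp).mdifferentiableAt (by simp)
  have hcomp := mfderiv_comp_apply t hφ hγ (1 : ℝ)
  rw [mfderiv_eq_fderiv] at hcomp
  refine Prod.ext rfl (hcomp.trans ?_)
  rw [← TangentBundle.continuousLinearMapAt_trivializationAt hp',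
    ← mfderivWithin_of_mem_nhds hs]
  exact (trivializationAt E (TangentSpace 𝓘(ℝ, E)) p).continuousLinearMapAt_apply_of_mem
      (R := ℝ) (by simpa using hp') (velocity γ s t)

end Lift

section Geodesic

variable {E : Type*} [NormedAddCommGroup E] [NormedSpace ℝ E]
  {M : Type*} [TopologicalSpace M] [ChartedSpace E M] [IsManifold 𝓘(ℝ, E) ∞ M]
  (g : Metric E M) {γ γ' : ℝ → M} {s s' : Set ℝ} {t : ℝ} {p : M}

/-- The two-sided version at an interior time of `Metric.IsGeodesicOn`: `γ` is smooth at `t` and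
its acceleration there vanishes. -/
def Metric.IsGeodesicAt (γ : ℝ → M) (t : ℝ) : Prop :=
  ContMDiffAt 𝓘(ℝ, ℝ) 𝓘(ℝ, E) ∞ γ t ∧
    ∀ p : M, γ t ∈ (extChartAt 𝓘(ℝ, E) p).source → g.acceleration p γ univ t = 0

lemma Metric.acceleration_univ (p : M) (γ : ℝ → M) (t : ℝ) :
    g.acceleration p γ univ t = deriv (deriv (extChartAt 𝓘(ℝ, E) p ∘ γ)) t
      + g.christoffel p (chartLift p γ t).1 (chartLift p γ t).2 (chartLift p γ t).2 := by
  simp only [acceleration, derivWithin_univ]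
  rfl

lemma Metric.acceleration_congr (hγ : γ =ᶠ[𝓝 t] γ') (hs : s =ᶠ[𝓝 t] s') (p : M) :
    g.acceleration p γ s t = g.acceleration p γ' s' t := by
  have hderiv := eventuallyEq_derivWithin (hγ.fun_comp (extChartAt 𝓘(ℝ, E) p)) hs
  have hderiv₂ := eventuallyEq_derivWithin hderiv hs
  simp only [Function.comp_def] at hderiv hderiv₂
  simp only [acceleration, hderiv₂.eq_of_nhds, hderiv.eq_of_nhds, hγ.eq_of_nhds]

variable {g}

lemma Metric.IsGeodesicAt.acceleration_eq_zero (h : g.IsGeodesicAt γ t) (hs : s ∈ 𝓝 t)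
    (hp : γ t ∈ (extChartAt 𝓘(ℝ, E) p).source) : g.acceleration p γ s t = 0 := by
  rw [g.acceleration_congr .rfl (eventuallyEq_univ.2 hs)]
  exact h.2 p hp

lemma Metric.IsGeodesicOn.isGeodesicAt (h : g.IsGeodesicOn γ s) (hs : s ∈ 𝓝 t) :
    g.IsGeodesicAt γ t :=
  ⟨h.1.contMDiffAt hs, fun p hp ↦ by
    rw [← g.acceleration_congr .rfl (eventuallyEq_univ.2 hs)]
    exact h.2 t (mem_of_mem_nhds hs) p hp⟩

lemma Metric.IsGeodesicAt.congr (h : g.IsGeodesicAt γ t) (hγ : γ' =ᶠ[𝓝 t] γ) :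
    g.IsGeodesicAt γ' t := by
  refine ⟨h.1.congr_of_eventuallyEq hγ, fun p hp ↦ ?_⟩
  rw [g.acceleration_congr (s' := univ) hγ .rfl]
  exact h.2 p (by rwa [← hγ.eq_of_nhds])

lemma Metric.IsGeodesicAt.hasDerivAt_chartLift (h : g.IsGeodesicAt γ t)
    (hp : γ t ∈ (extChartAt 𝓘(ℝ, E) p).source) :
    HasDerivAt (chartLift p γ) (g.spray p (chartLift p γ t)) t := by
  have hu := contDiffAt_extChartAt_comp h.1 hp
  have hu' := (hu.differentiableAt (by simp)).hasDerivAt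
  have hu'' := ((contDiffAt_deriv (n := ∞) hu).differentiableAt (by simp)).hasDerivAt
  have hacc := h.2 p hp
  rw [acceleration_univ] at hacc
  rw [eq_neg_of_add_eq_zero_left hacc] at hu''
  exact hu'.prodMk hu''

variable [FiniteDimensional ℝ E]

lemma Metric.isGeodesicAt_of_acceleration_eq_zero (hγ : ContMDiffAt 𝓘(ℝ, ℝ) 𝓘(ℝ, E) ∞ γ t)
    (hp : γ t ∈ (extChartAt 𝓘(ℝ, E) p).source) (hacc : g.acceleration p γ univ t = 0) :
    g.IsGeodesicAt γ t := by
  refine ⟨hγ, fun q hq ↦ ?_⟩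
  set u := extChartAt 𝓘(ℝ, E) p ∘ γ with hu
  have hu_smooth : ContDiffAt ℝ ∞ u t := contDiffAt_extChartAt_comp hγ hp
  have hsymm {τ : ℝ} (hτ : γ τ ∈ (extChartAt 𝓘(ℝ, E) p).source) :
      (extChartAt 𝓘(ℝ, E) p).symm (u τ) = γ τ := (extChartAt 𝓘(ℝ, E) p).left_inv hτ
  have hy : u t ∈ (extChartAt 𝓘(ℝ, E) p).target := (extChartAt 𝓘(ℝ, E) p).map_source hp
  have hq' : (extChartAt 𝓘(ℝ, E) p).symm (u t) ∈ (extChartAt 𝓘(ℝ, E) q).source := by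
    rwa [hsymm hp]
  have hψ := contDiffAt_chartChange hy hq'
  have hcomp : extChartAt 𝓘(ℝ, E) q ∘ γ =ᶠ[𝓝 t] chartChange p q ∘ u := by
    filter_upwards [hγ.continuousAt.eventually (extChartAt_source_mem_nhds' hp)] with τ hτ
    simp only [Function.comp_apply, chartChange, ← hsymm hτ]
  have hderiv : deriv (extChartAt 𝓘(ℝ, E) q ∘ γ) t =
      fderiv ℝ (chartChange (E := E) p q) (u t) (deriv u t) := by
    rw [hcomp.deriv_eq]
    exact (eventually_deriv_comp_eq (hψ.of_le (by simp)) (hu_smooth.of_le (by simp))).eq_of_nhds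
  have hlift : chartLift (E := E) q γ t = (chartChange p q (u t),
      fderiv ℝ (chartChange (E := E) p q) (u t) (deriv u t)) :=
    Prod.ext hcomp.eq_of_nhds hderiv
  rw [acceleration_univ, ← hu] at hacc
  rw [acceleration_univ, hcomp.deriv.deriv_eq, hlift,
    deriv_deriv_comp (hψ.of_le (WithTop.coe_le_coe.2 le_top))
      (hu_smooth.of_le (WithTop.coe_le_coe.2 le_top)), eq_neg_of_add_eq_zero_left hacc, map_neg]
  have hΓ := g.fderiv_chartChange_christoffel hy hq' (deriv u t)
  change _ + -fderiv ℝ (chartChange (E := E) p q) (u t)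
    (g.christoffel p (u t) (deriv u t) (deriv u t)) + _ = 0
  rw [hΓ]
  abel

lemma Metric.isGeodesicAt_of_hasDerivAt_spray {z : ℝ → E × E}
    (hz : ∀ᶠ τ in 𝓝 t, HasDerivAt z (g.spray p (z τ)) τ ∧
      (z τ).1 ∈ (extChartAt 𝓘(ℝ, E) p).target) :
    g.IsGeodesicAt (fun τ ↦ (extChartAt 𝓘(ℝ, E) p).symm (z τ).1) t ∧
      chartLift p (fun τ ↦ (extChartAt 𝓘(ℝ, E) p).symm (z τ).1) t = z t := by
  obtain ⟨hz', hmem⟩ := hz.self_of_nhds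
  have hsmooth : ContDiffAt ℝ ∞ z t := by
    refine contDiffAt_of_hasDerivAt_ode (F := g.spray p)
      (U := (extChartAt 𝓘(ℝ, E) p).target ×ˢ univ)
      (fun x hx ↦ (g.contDiffAt_spray hx.1).contDiffWithinAt) ?_
    filter_upwards [hz] with τ hτ using ⟨hτ.1, hτ.2, mem_univ _⟩
  have hfst : (extChartAt 𝓘(ℝ, E) p ∘ fun τ ↦ (extChartAt 𝓘(ℝ, E) p).symm (z τ).1) =ᶠ[𝓝 t]
      fun τ ↦ (z τ).1 := by
    filter_upwards [hz] with τ hτ using (extChartAt 𝓘(ℝ, E) p).right_inv hτ.2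
  have hsnd : deriv (extChartAt 𝓘(ℝ, E) p ∘ fun τ ↦ (extChartAt 𝓘(ℝ, E) p).symm (z τ).1) =ᶠ[𝓝 t]
      fun τ ↦ (z τ).2 := by
    refine hfst.deriv.trans ?_
    filter_upwards [hz] with τ hτ using (hasFDerivAt_fst.comp_hasDerivAt τ hτ.1).deriv
  have hlift : chartLift p (fun τ ↦ (extChartAt 𝓘(ℝ, E) p).symm (z τ).1) t = z t :=
    Prod.ext hfst.eq_of_nhds hsnd.eq_of_nhds
  refine ⟨isGeodesicAt_of_acceleration_eq_zero ?_ ((extChartAt 𝓘(ℝ, E) p).map_target hmem) ?_,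
    hlift⟩
  · exact (contMDiffAt_extChartAt_symm hmem).comp t (contDiffAt_fst.comp t hsmooth).contMDiffAt
  · have hsnd' : HasDerivAt (fun τ ↦ (z τ).2) (g.spray p (z t)).2 t :=
      (hasFDerivAt_snd (𝕜 := ℝ) (p := z t)).comp_hasDerivAt t hz'
    rw [acceleration_univ, hlift, hsnd.deriv_eq, hsnd'.deriv]
    exact neg_add_cancel _

end Geodesic

section Uniqueness

variable {E : Type*} [NormedAddCommGroup E] [NormedSpace ℝ E] [FiniteDimensional ℝ E]
  {M : Type*} [TopologicalSpace M] [ChartedSpace E M] [IsManifold 𝓘(ℝ, E) ∞ M]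
  {g : Metric E M} {γ γ' : ℝ → M} {s : Set ℝ} {t : ℝ} {p : M}

lemma Metric.eventuallyEq_of_chartLift_eq (hγ : ∀ᶠ τ in 𝓝 t, g.IsGeodesicAt γ τ)
    (hγ' : ∀ᶠ τ in 𝓝 t, g.IsGeodesicAt γ' τ) (hp : γ t ∈ (extChartAt 𝓘(ℝ, E) p).source)
    (hp' : γ' t ∈ (extChartAt 𝓘(ℝ, E) p).source)
    (h : chartLift (E := E) p γ t = chartLift p γ' t) : γ =ᶠ[𝓝 t] γ' := by
  have hz : (chartLift (E := E) p γ t).1 ∈ (extChartAt 𝓘(ℝ, E) p).target :=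
    (extChartAt 𝓘(ℝ, E) p).map_source hp
  obtain ⟨K, U, hU, hK⟩ := ((g.contDiffAt_spray hz).of_le (m := 1) (by simp)).exists_lipschitzOnWith
  have hsol (γ : ℝ → M) (hγ : ∀ᶠ τ in 𝓝 t, g.IsGeodesicAt γ τ)
      (hp : γ t ∈ (extChartAt 𝓘(ℝ, E) p).source) (hU : U ∈ 𝓝 (chartLift (E := E) p γ t)) :
      ∀ᶠ τ in 𝓝 t, (HasDerivAt (chartLift p γ) (g.spray p (chartLift p γ τ)) τ ∧
        chartLift p γ τ ∈ U) ∧ γ τ ∈ (extChartAt 𝓘(ℝ, E) p).source := by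
    have hγt := hγ.self_of_nhds.1
    filter_upwards [hγ, hγt.continuousAt.eventually (extChartAt_source_mem_nhds' hp),
      (contDiffAt_chartLift hγt hp).continuousAt.eventually hU] with τ hτ hτp hτU
    exact ⟨⟨hτ.hasDerivAt_chartLift hτp, hτU⟩, hτp⟩
  have hγsol := hsol γ hγ hp hU
  have hγ'sol := hsol γ' hγ' hp' (h ▸ hU)
  have heq := ODE_solution_unique_of_eventually (v := fun _ ↦ g.spray p) (s := fun _ ↦ U) (K := K)
    (Eventually.of_forall fun _ ↦ hK) (hγsol.mono fun _ h ↦ h.1) (hγ'sol.mono fun _ h ↦ h.1) h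
  filter_upwards [heq, hγsol, hγ'sol] with τ hτ hτp hτp'
  exact (extChartAt 𝓘(ℝ, E) p).injOn hτp.2 hτp'.2 (congrArg Prod.fst hτ)

theorem Metric.eventuallyEq_of_isPreconnected_of_chartLift_eq [T2Space M] (hs : IsPreconnected s)
    (hγ : ∀ᶠ τ in 𝓝ˢ s, g.IsGeodesicAt γ τ) (hγ' : ∀ᶠ τ in 𝓝ˢ s, g.IsGeodesicAt γ' τ)
    (ht : t ∈ s) (hp : γ t ∈ (extChartAt 𝓘(ℝ, E) p).source)
    (hp' : γ' t ∈ (extChartAt 𝓘(ℝ, E) p).source)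
    (h : chartLift (E := E) p γ t = chartLift p γ' t) : ∀ τ ∈ s, γ =ᶠ[𝓝 τ] γ' := by
  rw [eventually_nhdsSet_iff_forall] at hγ hγ'
  have hopen : IsOpen {τ | γ =ᶠ[𝓝 τ] γ'} :=
    isOpen_iff_mem_nhds.2 fun τ hτ ↦ eventually_eventuallyEq_nhds.2 hτ
  refine hs.subset_of_closure_inter_subset hopen
    ⟨t, ht, eventuallyEq_of_chartLift_eq (hγ t ht) (hγ' t ht) hp hp' h⟩ ?_
  rintro τ ⟨hτ_closure, hτ⟩
  have hfreq : ∃ᶠ τ' in 𝓝 τ, γ =ᶠ[𝓝 τ'] γ' := mem_closure_iff_frequently.1 hτ_closure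
  have hsmooth := (hγ τ hτ).self_of_nhds.1
  have hsmooth' := (hγ' τ hτ).self_of_nhds.1
  have heq : γ τ = γ' τ := tendsto_nhds_unique_of_frequently_eq hsmooth.continuousAt
    hsmooth'.continuousAt (hfreq.mono fun τ' hτ' ↦ hτ'.eq_of_nhds)
  have hp : γ τ ∈ (extChartAt 𝓘(ℝ, E) (γ τ)).source := mem_extChartAt_source _
  have hp' : γ' τ ∈ (extChartAt 𝓘(ℝ, E) (γ τ)).source := heq ▸ hp
  exact eventuallyEq_of_chartLift_eq (hγ τ hτ) (hγ' τ hτ) hp hp'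
    (tendsto_nhds_unique_of_frequently_eq (contDiffAt_chartLift hsmooth hp).continuousAt
      (contDiffAt_chartLift hsmooth' hp').continuousAt (hfreq.mono fun τ' hτ' ↦
        chartLift_congr hτ' _))

end Uniqueness

section Extension

lemma Ico_eventuallyEq_Ico_of_lt {a b b' t : ℝ} (hb : t < b) (hb' : t < b') :
    Ico a b =ᶠ[𝓝 t] Ico a b' := by
  filter_upwards [Iio_mem_nhds hb, Iio_mem_nhds hb'] with τ hτ hτ'
  exact propext (and_congr_right fun _ ↦ iff_of_true hτ hτ')

variable {E : Type*} [NormedAddCommGroup E] [NormedSpace ℝ E]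
  {M : Type*} [TopologicalSpace M] [ChartedSpace E M] [IsManifold 𝓘(ℝ, E) ∞ M]
  {g : Metric E M}

lemma Metric.IsGeodesicOn.Ico_of_forall_isGeodesicAt {γ σ : ℝ → M} {a b b' : ℝ}
    (hγ : g.IsGeodesicOn γ (Ico a b)) (hσγ : EqOn σ γ (Iio b))
    (hσ : ∀ t ∈ Ico b b', g.IsGeodesicAt σ t) (hab : a < b) : g.IsGeodesicOn σ (Ico a b') := by
  have hσγ_nhds {t : ℝ} (ht : t < b) : σ =ᶠ[𝓝 t] γ := eventually_of_mem (Iio_mem_nhds ht) hσγ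
  refine ⟨fun t ht ↦ ?_, fun t ht p hp ↦ ?_⟩ <;> rcases lt_or_ge t b with htb | hbt
  · exact ((hγ.1 t ⟨ht.1, htb⟩).congr_set
      (Ico_eventuallyEq_Ico_of_lt htb ht.2)).congr_of_eventuallyEq
      ((hσγ_nhds htb).filter_mono nhdsWithin_le_nhds) (hσγ_nhds htb).eq_of_nhds
  · exact (hσ t ⟨hbt, ht.2⟩).1.contMDiffWithinAt
  · rw [g.acceleration_congr (hσγ_nhds htb) (Ico_eventuallyEq_Ico_of_lt ht.2 htb)]
    exact hγ.2 t ⟨ht.1, htb⟩ p (by rwa [← (hσγ_nhds htb).eq_of_nhds])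
  · exact (hσ t ⟨hbt, ht.2⟩).acceleration_eq_zero (Ico_mem_nhds (hab.trans_le hbt) ht.2) hp

variable {γ : ℝ → M} {b : ℝ}

lemma Metric.IsGeodesicOn.isExtendibleBeyond_of_eqOn {β : ℝ → M} {a b' : ℝ}
    (hγ : g.IsGeodesicOn γ (Ico 0 b)) (hb : 0 < b) (hab : a < b) (hbb' : b < b')
    (hβ : ∀ t ∈ Ioo a b', g.IsGeodesicAt β t) (heq : EqOn γ β (Ioo a b)) :
    g.IsExtendibleBeyond γ b := by
  refine ⟨b', hbb', (Iio b).piecewise γ β, hγ.Ico_of_forall_isGeodesicAt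
    (piecewise_eqOn _ _ _) (fun t ht ↦ ?_) hb, (piecewise_eqOn _ _ _).mono fun t ht ↦ ht.2⟩
  refine (hβ t ⟨hab.trans_le ht.1, ht.2⟩).congr ?_
  filter_upwards [Ioi_mem_nhds (hab.trans_le ht.1)] with τ hτ
  by_cases hτb : τ < b
  · rw [piecewise_eq_of_mem (Iio b) _ _ hτb, heq ⟨hτ, hτb⟩]
  · exact piecewise_eq_of_notMem (Iio b) _ _ hτb

variable [FiniteDimensional ℝ E]

lemma Metric.exists_isGeodesicAt_of_hasDerivAt_spray {p : M} {z : ℝ → E × E} {ε : ℝ}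
    (hz : ∀ t ∈ Icc (-ε) ε, HasDerivAt z (g.spray p (z t)) t ∧
      (z t).1 ∈ (extChartAt 𝓘(ℝ, E) p).target) (t₀ : ℝ) :
    ∃ β : ℝ → M, ∀ t ∈ Ioo (t₀ - ε) (t₀ + ε), g.IsGeodesicAt β t ∧
      β t ∈ (extChartAt 𝓘(ℝ, E) p).source ∧ chartLift p β t = z (t - t₀) := by
  refine ⟨fun τ ↦ (extChartAt 𝓘(ℝ, E) p).symm (z (τ - t₀)).1, fun t ht ↦ ?_⟩
  have hsol : ∀ᶠ τ in 𝓝 t, HasDerivAt (fun τ ↦ z (τ - t₀)) (g.spray p (z (τ - t₀))) τ ∧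
      (z (τ - t₀)).1 ∈ (extChartAt 𝓘(ℝ, E) p).target := by
    filter_upwards [Ioo_mem_nhds ht.1 ht.2] with τ hτ
    obtain ⟨hderiv, hmem⟩ := hz (τ - t₀) ⟨by linarith [hτ.1], by linarith [hτ.2]⟩
    exact ⟨hderiv.comp_sub_const τ t₀, hmem⟩
  obtain ⟨hβ, hlift⟩ := isGeodesicAt_of_hasDerivAt_spray hsol
  exact ⟨hβ, (extChartAt 𝓘(ℝ, E) p).map_target hsol.self_of_nhds.2, hlift⟩

variable (g) in
lemma Metric.exists_isGeodesicAt_of_mem_closedBall {p : M} {z₀ : E × E}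
    (hz₀ : z₀.1 ∈ (extChartAt 𝓘(ℝ, E) p).target) :
    ∃ ε > 0, ∀ z ∈ Metric.closedBall z₀ ε, ∀ t₀ : ℝ, ∃ β : ℝ → M,
      (∀ t ∈ Ioo (t₀ - ε) (t₀ + ε), g.IsGeodesicAt β t ∧
        β t ∈ (extChartAt 𝓘(ℝ, E) p).source) ∧ chartLift p β t₀ = z := by
  have hU : (extChartAt 𝓘(ℝ, E) p).target ×ˢ (univ : Set E) ∈ 𝓝 z₀ :=
    ((isOpen_extChartAt_target p).prod isOpen_univ).mem_nhds ⟨hz₀, mem_univ _⟩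
  obtain ⟨ε, hε, α, -, hα, -⟩ :=
    exists_local_flow ((g.contDiffAt_spray hz₀).of_le (m := 1) (by simp)) hU
  refine ⟨ε, hε, fun z hz t₀ ↦ ?_⟩
  obtain ⟨β, hβ⟩ := exists_isGeodesicAt_of_hasDerivAt_spray
    (fun t ht ↦ ⟨((hα z hz).2 t ht).1, ((hα z hz).2 t ht).2.1⟩) t₀
  refine ⟨β, fun t ht ↦ ⟨(hβ t ht).1, (hβ t ht).2.1⟩, ?_⟩
  rw [(hβ t₀ ⟨by linarith, by linarith⟩).2.2, sub_self, (hα z hz).1]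

variable [T2Space M]

theorem Metric.IsGeodesicOn.isExtendibleBeyond_of_tendsto_chartLift
    (hγ : g.IsGeodesicOn γ (Ico 0 b)) {p : M} {z₀ : E × E}
    (hz₀ : z₀.1 ∈ (extChartAt 𝓘(ℝ, E) p).target) {s : ℕ → ℝ} (hs : ∀ᶠ n in atTop, s n ∈ Ioo 0 b)
    (hsb : Tendsto s atTop (𝓝 b)) (hsp : ∀ᶠ n in atTop, γ (s n) ∈ (extChartAt 𝓘(ℝ, E) p).source)
    (hlim : Tendsto (fun n ↦ chartLift p γ (s n)) atTop (𝓝 z₀)) : g.IsExtendibleBeyond γ b := by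
  obtain ⟨ε, hε, hflow⟩ := g.exists_isGeodesicAt_of_mem_closedBall hz₀
  obtain ⟨n, hn, hnp, hnz, hnε⟩ := (hs.and (hsp.and ((hlim.eventually_mem
    (Metric.closedBall_mem_nhds z₀ hε)).and (hsb.eventually_mem
      (Ioi_mem_nhds (sub_lt_self b hε)))))).exists
  rw [mem_Ioi] at hnε
  obtain ⟨β, hβ, hβn⟩ := hflow _ hnz (s n)
  have hsn : s n ∈ Ioo (max 0 (s n - ε)) b := ⟨max_lt hn.1 (by linarith), hn.2⟩
  have hγβ : ∀ t ∈ Ioo (max 0 (s n - ε)) b, γ =ᶠ[𝓝 t] β := by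
    refine eventuallyEq_of_isPreconnected_of_chartLift_eq (g := g) isPreconnected_Ioo ?_ ?_ hsn hnp
      (hβ (s n) ⟨by linarith, by linarith⟩).2 hβn.symm <;>
      rw [isOpen_Ioo.nhdsSet_eq, eventually_principal] <;>
      intro t ht
    · exact hγ.isGeodesicAt (Ico_mem_nhds ((le_max_left _ _).trans_lt ht.1) ht.2)
    · exact (hβ t ⟨(le_max_right _ _).trans_lt ht.1, by linarith [ht.2]⟩).1
  refine hγ.isExtendibleBeyond_of_eqOn (hn.1.trans hn.2) (hsn.1.trans hsn.2)
    (show b < s n + ε by linarith) (fun t ht ↦ (hβ t ⟨(le_max_right _ _).trans_lt ht.1, ht.2⟩).1)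
    fun t ht ↦ (hγβ t ht).eq_of_nhds

theorem Metric.IsGeodesicOn.isExtendibleBeyond_of_tendsto_velocity
    (hγ : g.IsGeodesicOn γ (Ico 0 b)) {s : ℕ → ℝ} (hs : ∀ᶠ n in atTop, s n ∈ Ioo 0 b)
    (hsb : Tendsto s atTop (𝓝 b)) {v : TangentBundle 𝓘(ℝ, E) M}
    (hv : Tendsto (fun n ↦ (⟨γ (s n), velocity γ (Ico 0 b) (s n)⟩ : TangentBundle 𝓘(ℝ, E) M))
      atTop (𝓝 v)) : g.IsExtendibleBeyond γ b := by
  have hproj : Tendsto (fun n ↦ γ (s n)) atTop (𝓝 v.1) :=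
    ((FiberBundle.continuous_proj E (TangentSpace 𝓘(ℝ, E) (M := M))).tendsto v).comp hv
  have hsp : ∀ᶠ n in atTop, γ (s n) ∈ (extChartAt 𝓘(ℝ, E) v.1).source :=
    hproj.eventually_mem (extChartAt_source_mem_nhds v.1)
  refine hγ.isExtendibleBeyond_of_tendsto_chartLift (mem_extChartAt_target v.1) hs hsb hsp
    (((continuousAt_tangentChart (mem_extChartAt_source v.1)).tendsto.comp hv).congr' ?_)
  filter_upwards [hs, hsp] with n hn hnp
  exact (chartLift_eq_tangentChart_velocity (Ico_mem_nhds hn.1 hn.2)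
    ((hγ.1.contMDiffAt (Ico_mem_nhds hn.1 hn.2)).mdifferentiableAt (by simp)) hnp).symm

end Extension

section SecondCountable

lemma exists_countable_mem_forall_subset {X : Type*} (C : X → ℕ → Set X)
    (hC : ∀ x n, (C x n).Countable) (x₀ : X) :
    ∃ A : Set X, A.Countable ∧ x₀ ∈ A ∧ ∀ x ∈ A, ∀ n, C x n ⊆ A := by
  let A (k : ℕ) : Set X := (fun A ↦ ⋃ x ∈ A, ⋃ n, C x n)^[k] {x₀}
  have hA (k : ℕ) : (A k).Countable := by
    induction k with
    | zero => exact countable_singleton x₀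
    | succ k ih =>
      simp only [A, Function.iterate_succ_apply']
      exact ih.biUnion fun x _ ↦ countable_iUnion fun n ↦ hC x n
  refine ⟨⋃ k, A k, countable_iUnion hA, mem_iUnion.2 ⟨0, rfl⟩, fun x hx n y hy ↦ ?_⟩
  obtain ⟨k, hk⟩ := mem_iUnion.1 hx
  refine mem_iUnion.2 ⟨k + 1, ?_⟩
  simp only [A, Function.iterate_succ_apply']
  exact mem_biUnion hk (mem_iUnion.2 ⟨n, hy⟩)

lemma exists_countable_subset_forall_inter_subset {X ι : Type*} [TopologicalSpace X] {s : Set X}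
    [SecondCountableTopology s] (I : Set ι) {W : ι → Set X} (hW : ∀ i ∈ I, IsOpen (W i)) :
    ∃ T ⊆ I, T.Countable ∧ ∀ i ∈ I, s ∩ W i ⊆ ⋃ j ∈ T, W j := by
  obtain ⟨T, hTI, hT, hcover⟩ := TopologicalSpace.isOpen_biUnion_countable I
    (fun i ↦ ((↑) : s → X) ⁻¹' W i) fun i hi ↦ (hW i hi).preimage continuous_subtype_val
  refine ⟨T, hTI, hT, fun i hi x ⟨hxs, hxi⟩ ↦ ?_⟩
  have hx : (⟨x, hxs⟩ : s) ∈ ⋃ i ∈ I, ((↑) : s → X) ⁻¹' W i := mem_biUnion hi hxi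
  rw [← hcover, mem_iUnion₂] at hx
  exact mem_iUnion₂.2 hx

variable {E : Type*} [NormedAddCommGroup E] [NormedSpace ℝ E]
  {M : Type*} [TopologicalSpace M] [ChartedSpace E M] [IsManifold 𝓘(ℝ, E) ∞ M]

lemma injOn_tangentChart (p : M) :
    InjOn (tangentChart (E := E) p) {v | v.1 ∈ (extChartAt 𝓘(ℝ, E) p).source} := by
  intro v hv w hw hvw
  have hv' : v.1 ∈ (chartAt E p).source := by simpa using hv
  have hw' : w.1 ∈ (chartAt E p).source := by simpa using hw
  have hproj : v.1 = w.1 := (extChartAt 𝓘(ℝ, E) p).injOn hv hw (congrArg Prod.fst hvw)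
  set e := trivializationAt E (TangentSpace 𝓘(ℝ, E)) p
  have hve : v ∈ e.source := by simpa [e, Bundle.Trivialization.mem_source] using hv'
  have hwe : w ∈ e.source := by simpa [e, Bundle.Trivialization.mem_source] using hw'
  exact e.toOpenPartialHomeomorph.injOn hve hwe (Prod.ext
    ((e.coe_fst hve).trans (hproj.trans (e.coe_fst hwe).symm)) (congrArg Prod.snd hvw :))

lemma isOpen_inter_preimage_tangentChart (p : M) {U : Set (E × E)} (hU : IsOpen U) :
    IsOpen ({v | v.1 ∈ (extChartAt 𝓘(ℝ, E) p).source} ∩ tangentChart p ⁻¹' U) := by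
  have hopen : IsOpen {v : TangentBundle 𝓘(ℝ, E) M | v.1 ∈ (extChartAt 𝓘(ℝ, E) p).source} :=
    (isOpen_extChartAt_source p).preimage (FiberBundle.continuous_proj E _)
  exact ContinuousOn.isOpen_inter_preimage
    (fun v hv ↦ (continuousAt_tangentChart hv).continuousWithinAt) hopen hU

lemma secondCountableTopology_tangentBundle_over_extChartAt_source [FiniteDimensional ℝ E] (p : M) :
    SecondCountableTopology
      {v : TangentBundle 𝓘(ℝ, E) M | v.1 ∈ (extChartAt 𝓘(ℝ, E) p).source} := by
  have : ProperSpace E := FiniteDimensional.proper ℝ E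
  have : SecondCountableTopology (ModelProd E E) :=
    inferInstanceAs (SecondCountableTopology (E × E))
  have hsource : {v : TangentBundle 𝓘(ℝ, E) M | v.1 ∈ (extChartAt 𝓘(ℝ, E) p).source} =
      (chartAt (ModelProd E E) (⟨p, 0⟩ : TangentBundle 𝓘(ℝ, E) M)).source := by
    ext v
    simp [TangentBundle.mem_chart_source_iff]
  rw [hsource]
  exact (chartAt (ModelProd E E)
    (⟨p, 0⟩ : TangentBundle 𝓘(ℝ, E) M)).secondCountableTopology_source

/-- `x` is the position at time `τ` of a geodesic, defined on a neighborhood of `[0, τ]`, with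
initial velocity `v`. -/
def Metric.IsEndpoint (g : Metric E M) (v : TangentBundle 𝓘(ℝ, E) M) (τ : ℝ) (x : M) : Prop :=
  ∃ σ : ℝ → M, (∀ᶠ t in 𝓝ˢ (Icc 0 τ), g.IsGeodesicAt σ t) ∧
    (⟨σ 0, velocity σ univ 0⟩ : TangentBundle 𝓘(ℝ, E) M) = v ∧ σ τ = x

variable {g : Metric E M}

lemma Metric.IsEndpoint.of_forall_isGeodesicAt {σ : ℝ → M} {a b τ : ℝ} (ha : a < 0) (hb : τ < b)
    (hσ : ∀ t ∈ Ioo a b, g.IsGeodesicAt σ t) :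
    g.IsEndpoint ⟨σ 0, velocity σ univ 0⟩ τ (σ τ) :=
  ⟨σ, mem_of_superset (isOpen_Ioo.mem_nhdsSet.2 (Icc_subset_Ioo ha hb)) hσ, rfl, rfl⟩

variable [FiniteDimensional ℝ E]

lemma Metric.IsEndpoint.eq [T2Space M] {v : TangentBundle 𝓘(ℝ, E) M} {τ : ℝ} {x x' : M}
    (hx : g.IsEndpoint v τ x) (hx' : g.IsEndpoint v τ x') (hτ : 0 ≤ τ) : x = x' := by
  obtain ⟨σ, hσ, hv, rfl⟩ := hx
  obtain ⟨σ', hσ', hv', rfl⟩ := hx'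
  have hlift (σ : ℝ → M) (hσ : ∀ᶠ t in 𝓝ˢ (Icc 0 τ), g.IsGeodesicAt σ t)
      (hv : (⟨σ 0, velocity σ univ 0⟩ : TangentBundle 𝓘(ℝ, E) M) = v) :
      σ 0 ∈ (extChartAt 𝓘(ℝ, E) v.1).source ∧ chartLift v.1 σ 0 = tangentChart v.1 v := by
    subst hv
    have hsmooth := (hσ.self_of_nhdsSet 0 (left_mem_Icc.2 hτ)).1
    exact ⟨mem_extChartAt_source _, chartLift_eq_tangentChart_velocity univ_mem
      (hsmooth.mdifferentiableAt (by simp)) (mem_extChartAt_source _)⟩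
  obtain ⟨hp, hlift_σ⟩ := hlift σ hσ hv
  obtain ⟨hp', hlift_σ'⟩ := hlift σ' hσ' hv'
  exact (eventuallyEq_of_isPreconnected_of_chartLift_eq isPreconnected_Icc hσ hσ'
    (left_mem_Icc.2 hτ) hp hp' (hlift_σ.trans hlift_σ'.symm) τ (right_mem_Icc.2 hτ)).eq_of_nhds

variable (g)

lemma Metric.exists_isEndpoint_of_tangentChart_mem_ball (x : M) :
    ∃ ε > 0, ∀ v : TangentBundle 𝓘(ℝ, E) M, v.1 ∈ (extChartAt 𝓘(ℝ, E) x).source →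
      tangentChart x v ∈ Metric.ball (extChartAt 𝓘(ℝ, E) x x, (0 : E)) ε → ∀ τ ∈ Ico 0 ε,
        ∃ y ∈ (extChartAt 𝓘(ℝ, E) x).source, g.IsEndpoint v τ y := by
  obtain ⟨ε, hε, hflow⟩ := g.exists_isGeodesicAt_of_mem_closedBall
    (z₀ := (extChartAt 𝓘(ℝ, E) x x, (0 : E))) (mem_extChartAt_target x)
  refine ⟨ε, hε, fun v hvx hv τ hτ ↦ ?_⟩
  obtain ⟨σ, hσ, hσ₀⟩ := hflow _ (Metric.ball_subset_closedBall hv) 0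
  simp only [zero_sub, zero_add] at hσ
  obtain ⟨hgeo₀, hmem₀⟩ := hσ 0 ⟨neg_lt_zero.2 hε, hε⟩
  have hvelocity : (⟨σ 0, velocity σ univ 0⟩ : TangentBundle 𝓘(ℝ, E) M) = v := by
    refine injOn_tangentChart x hmem₀ hvx ?_
    rw [← hσ₀, chartLift_eq_tangentChart_velocity univ_mem
      (hgeo₀.1.mdifferentiableAt (by simp)) hmem₀]
  refine ⟨σ τ, (hσ τ ⟨by linarith [hτ.1], hτ.2⟩).2, hvelocity ▸ ?_⟩
  exact .of_forall_isGeodesicAt (neg_lt_zero.2 hε) hτ.2 fun t ht ↦ (hσ t ht).1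

lemma Metric.eventually_exists_isEndpoint (x : M) {U : Set (E × E)}
    (hU : U ∈ 𝓝 (extChartAt 𝓘(ℝ, E) x x, (0 : E))) :
    ∃ ε > 0, ∀ τ ∈ Ioo 0 ε, ∀ᶠ y in 𝓝 x, ∃ v : TangentBundle 𝓘(ℝ, E) M,
      v.1 = y ∧ tangentChart x v ∈ U ∧ g.IsEndpoint v τ x := by
  have hx : extChartAt 𝓘(ℝ, E) x x ∈ (extChartAt 𝓘(ℝ, E) x).target := mem_extChartAt_target x
  have htarget : (extChartAt 𝓘(ℝ, E) x).target ×ˢ (univ : Set E) ∈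
      𝓝 (extChartAt 𝓘(ℝ, E) x x, (0 : E)) :=
    ((isOpen_extChartAt_target x).prod isOpen_univ).mem_nhds ⟨hx, mem_univ _⟩
  obtain ⟨ε, hε, hsol⟩ := exists_solution_through
    ((g.contDiffAt_spray (z := (extChartAt 𝓘(ℝ, E) x x, 0)) hx).of_le (m := 1) (by simp)).snd
    (congrArg Prod.snd (g.spray_zero x _)) (inter_mem htarget hU)
  refine ⟨ε, hε, fun τ hτ ↦ ?_⟩
  have hsolτ := hsol (-τ) (neg_ne_zero.2 hτ.1.ne') (by rw [abs_neg, abs_of_pos hτ.1]; exact hτ.2)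
  filter_upwards [(continuousAt_extChartAt x).eventually hsolτ,
    extChartAt_source_mem_nhds (I := 𝓘(ℝ, E)) x] with y ⟨z, hz, hz₀, hzτ⟩ hy
  obtain ⟨σ, hσ⟩ := g.exists_isGeodesicAt_of_hasDerivAt_spray
    (fun t ht ↦ ⟨(hz t ht).1, (hz t ht).2.1.1⟩) τ
  obtain ⟨hgeo₀, hmem₀, hσ₀⟩ := hσ 0 ⟨by linarith [hτ.2], by linarith [hτ.1]⟩
  obtain ⟨-, hmemτ, hστ⟩ := hσ τ ⟨by linarith, by linarith⟩
  rw [zero_sub] at hσ₀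
  rw [sub_self] at hστ
  have hy₀ : σ 0 = y := (extChartAt 𝓘(ℝ, E) x).injOn hmem₀ hy ((congrArg Prod.fst hσ₀).trans hzτ)
  have hxτ : σ τ = x := (extChartAt 𝓘(ℝ, E) x).injOn hmemτ (mem_extChartAt_source x)
    ((congrArg Prod.fst hστ).trans hz₀)
  refine ⟨⟨σ 0, velocity σ univ 0⟩, hy₀, ?_, ?_⟩
  · rw [← chartLift_eq_tangentChart_velocity univ_mem (hgeo₀.1.mdifferentiableAt (by simp)) hmem₀,
      hσ₀]
    exact (hz (-τ) ⟨by linarith [hτ.2], by linarith [hτ.1]⟩).2.2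
  · have hend : g.IsEndpoint ⟨σ 0, velocity σ univ 0⟩ τ (σ τ) :=
      .of_forall_isGeodesicAt (sub_neg.2 hτ.2) (lt_add_of_pos_right τ hε) fun t ht ↦ (hσ t ht).1
    rwa [hxτ] at hend

lemma Metric.exists_isOpen_forall_isEndpoint (x : M) :
    ∃ n : ℕ, ∃ W : Set (TangentBundle 𝓘(ℝ, E) M), IsOpen W ∧
      (∀ v ∈ W, ∃ y ∈ (extChartAt 𝓘(ℝ, E) x).source, g.IsEndpoint v (1 / (n + 1)) y) ∧
      ∀ᶠ y in 𝓝 x, ∃ v ∈ W, v.1 = y ∧ g.IsEndpoint v (1 / (n + 1)) x := by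
  obtain ⟨ε, hε, hball⟩ := g.exists_isEndpoint_of_tangentChart_mem_ball x
  obtain ⟨δ, hδ, hnear⟩ := g.eventually_exists_isEndpoint x (Metric.ball_mem_nhds _ hε)
  obtain ⟨n, hn⟩ := exists_nat_one_div_lt (lt_min hε hδ)
  have hpos : (0 : ℝ) < 1 / (n + 1) := Nat.one_div_pos_of_nat
  refine ⟨n, _, isOpen_inter_preimage_tangentChart x Metric.isOpen_ball,
    fun v hv ↦ hball v hv.1 hv.2 _ ⟨hpos.le, hn.trans_le (min_le_left _ _)⟩, ?_⟩
  filter_upwards [hnear _ ⟨hpos, hn.trans_le (min_le_right _ _)⟩,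
    extChartAt_source_mem_nhds (I := 𝓘(ℝ, E)) x] with y ⟨v, hvy, hv, hvx⟩ hy
  exact ⟨v, ⟨by rwa [mem_ofPred_eq, hvy], hv⟩, hvy, hvx⟩

/-- Every point is the endpoint of short geodesics issuing from all nearby points. For each duration
`1 / (n + 1)`, the geodesics issuing from a single chart domain end in countably many chart domains,
so the chart domains that can be reached from a given one form a countable family whose union is
clopen. -/
theorem Metric.secondCountableTopology (g : Metric E M) [T2Space M] [ConnectedSpace M] :
    SecondCountableTopology M := by
  choose n W hW hWsource hWreach using g.exists_isOpen_forall_isEndpoint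
  have hcover (p : M) (k : ℕ) :=
    have := secondCountableTopology_tangentBundle_over_extChartAt_source (E := E) p
    exists_countable_subset_forall_inter_subset {q | n q = k} (W := W)
      (s := {v | v.1 ∈ (extChartAt 𝓘(ℝ, E) p).source}) fun q _ ↦ hW q
  choose C hCn hC hCcover using hcover
  obtain ⟨x₀⟩ : Nonempty M := inferInstance
  obtain ⟨A, hA, hx₀, hAC⟩ := exists_countable_mem_forall_subset C hC x₀
  have hclosed : IsClosed (⋃ p ∈ A, (extChartAt 𝓘(ℝ, E) p).source) := by
    refine isClosed_of_closure_subset fun x hx ↦ ?_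
    obtain ⟨y, hy, v, hv, rfl, hvx⟩ :=
      ((mem_closure_iff_frequently.1 hx).and_eventually (hWreach x)).exists
    obtain ⟨p, hp, hyp⟩ := mem_iUnion₂.1 hy
    obtain ⟨q, hq, hvq⟩ := mem_iUnion₂.1 (hCcover p (n x) x rfl ⟨hyp, hv⟩)
    obtain ⟨x', hx', hvx'⟩ := hWsource q v hvq
    rw [show n q = n x from hCn p (n x) hq] at hvx'
    obtain rfl := hvx.eq hvx' Nat.one_div_pos_of_nat.le
    exact mem_biUnion (hAC p hp (n x) hq) hx'
  have huniv : ⋃ p ∈ A, (extChartAt 𝓘(ℝ, E) p).source = univ :=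
    IsClopen.eq_univ ⟨hclosed, isOpen_biUnion fun p _ ↦ isOpen_extChartAt_source p⟩
      ⟨x₀, mem_biUnion hx₀ (mem_extChartAt_source x₀)⟩
  have : ProperSpace E := FiniteDimensional.proper ℝ E
  exact ChartedSpace.secondCountable_of_countable_cover E
    (by simpa only [extChartAt_source] using huniv) hA

end SecondCountable

section Distance

variable {E : Type*} [NormedAddCommGroup E] [NormedSpace ℝ E]
  {M : Type*} [TopologicalSpace M] [ChartedSpace E M] [IsManifold 𝓘(ℝ, E) ∞ M]
  (gR : RiemMetric E M)

lemma isContinuousRiemannianBundle :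
    letI : Bundle.RiemannianBundle (fun x : M ↦ TangentSpace 𝓘(ℝ, E) x) := ⟨gR.toRiemannianMetric⟩
    IsContinuousRiemannianBundle E (fun x : M ↦ TangentSpace 𝓘(ℝ, E) x) := by
  let : Bundle.RiemannianBundle (fun x : M ↦ TangentSpace 𝓘(ℝ, E) x) := ⟨gR.toRiemannianMetric⟩
  exact ⟨gR.inner, gR.contMDiff.continuous, fun _ _ _ ↦ rfl⟩

lemma norm_eq_sqrt_inner {x : M} (v : TangentSpace 𝓘(ℝ, E) x) :
    letI : Bundle.RiemannianBundle (fun x : M ↦ TangentSpace 𝓘(ℝ, E) x) := ⟨gR.toRiemannianMetric⟩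
    ‖v‖ = √(gR.inner x v v) :=
  let : Bundle.RiemannianBundle (fun x : M ↦ TangentSpace 𝓘(ℝ, E) x) := ⟨gR.toRiemannianMetric⟩
  norm_eq_sqrt_real_inner v

lemma enorm_eq_ofReal_sqrt_inner {x : M} (v : TangentSpace 𝓘(ℝ, E) x) :
    letI : Bundle.RiemannianBundle (fun x : M ↦ TangentSpace 𝓘(ℝ, E) x) := ⟨gR.toRiemannianMetric⟩
    ‖v‖ₑ = ENNReal.ofReal √(gR.inner x v v) := by
  let : Bundle.RiemannianBundle (fun x : M ↦ TangentSpace 𝓘(ℝ, E) x) := ⟨gR.toRiemannianMetric⟩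
  rw [← norm_eq_sqrt_inner, ofReal_norm]

lemma riemDist_comm (x y : M) : riemDist gR x y = riemDist gR y x :=
  let : Bundle.RiemannianBundle (fun x : M ↦ TangentSpace 𝓘(ℝ, E) x) := ⟨gR.toRiemannianMetric⟩
  Manifold.riemannianEDist_comm

lemma riemDist_triangle (x y z : M) : riemDist gR x z ≤ riemDist gR x y + riemDist gR y z :=
  let : Bundle.RiemannianBundle (fun x : M ↦ TangentSpace 𝓘(ℝ, E) x) := ⟨gR.toRiemannianMetric⟩
  Manifold.riemannianEDist_triangle

lemma eventually_riemDist_lt (y : M) {c : ℝ≥0∞} (hc : 0 < c) :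
    ∀ᶠ x in 𝓝 y, riemDist gR x y < c := by
  let : Bundle.RiemannianBundle (fun x : M ↦ TangentSpace 𝓘(ℝ, E) x) := ⟨gR.toRiemannianMetric⟩
  have := isContinuousRiemannianBundle gR
  simp only [riemDist_comm gR _ y]
  exact eventually_riemannianEDist_lt 𝓘(ℝ, E) y hc

variable {gR}

lemma tendsto_of_tendsto_riemDist [RegularSpace M] {ι : Type*} {l : Filter ι} {u : ι → M} {y : M}
    (hu : Tendsto (fun i ↦ riemDist gR (u i) y) l (𝓝 0)) : Tendsto u l (𝓝 y) := by
  let : Bundle.RiemannianBundle (fun x : M ↦ TangentSpace 𝓘(ℝ, E) x) := ⟨gR.toRiemannianMetric⟩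
  have := isContinuousRiemannianBundle gR
  intro V hV
  obtain ⟨c, hc, hcV⟩ := setOfPred_riemannianEDist_lt_subset_nhds' 𝓘(ℝ, E) hV
  simp only [riemDist_comm gR _ y] at hu
  exact (hu.eventually_lt_const hc).mono fun i hi ↦ hcV hi

lemma enorm_sub_le_riemDist {f : M → ℝ} (hf : ContMDiff 𝓘(ℝ, E) 𝓘(ℝ, ℝ) 1 f)
    (hfg : ∀ x v, mvfderiv 𝓘(ℝ, E) f x v ^ 2 ≤ gR.inner x v v) (x y : M) :
    ‖f y - f x‖ₑ ≤ riemDist gR x y := by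
  let : Bundle.RiemannianBundle (fun x : M ↦ TangentSpace 𝓘(ℝ, E) x) := ⟨gR.toRiemannianMetric⟩
  refine le_of_forall_gt fun r hr ↦ ?_
  obtain ⟨c, rfl, rfl, hc, hlen⟩ := Manifold.exists_lt_of_riemannianEDist_lt hr
  refine lt_of_le_of_lt ?_ hlen
  rw [Manifold.pathELength_eq_lintegral_mfderivWithin_Icc]
  refine (enorm_sub_le_lintegral_derivWithin_Icc_of_contDiffOn_Icc
    (hf.comp_contMDiffOn hc).contDiffOn zero_le_one).trans
    (MeasureTheory.setLIntegral_mono' measurableSet_Icc fun t ht ↦ ?_)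
  have hderiv : derivWithin (f ∘ c) (Icc 0 1) t =
      mvfderiv 𝓘(ℝ, E) f (c t) (mfderivWithin 𝓘(ℝ, ℝ) 𝓘(ℝ, E) c (Icc 0 1) t (1 : ℝ)) := by
    have hchain := mvfderiv_comp_mfderivWithin t ((hf (c t)).mdifferentiableAt one_ne_zero)
      (hc.mdifferentiableOn one_ne_zero t ht)
      (uniqueDiffOn_Icc zero_lt_one t ht).uniqueMDiffWithinAt
    rw [mvfderivWithin, mfderivWithin_eq_fderivWithin] at hchain
    exact congrArg (fun L : ℝ →L[ℝ] ℝ ↦ L 1) hchain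
  rw [enorm_eq_ofReal_sqrt_inner, Real.enorm_eq_ofReal_abs, hderiv]
  exact ENNReal.ofReal_le_ofReal (Real.abs_le_sqrt (hfg _ _))

theorem isCompleteMetric_of_tendsto_cocompact {f : M → ℝ} (hf : ContMDiff 𝓘(ℝ, E) 𝓘(ℝ, ℝ) 1 f)
    (hf_proper : Tendsto f (cocompact M) atTop)
    (hfg : ∀ x v, mvfderiv 𝓘(ℝ, E) f x v ^ 2 ≤ gR.inner x v v) : IsCompleteMetric gR := by
  intro x hx
  obtain ⟨N, hN⟩ := hx 1 one_pos
  obtain ⟨K, hK, hKf⟩ := mem_cocompact.1 (hf_proper.eventually_gt_atTop (f (x N) + 1))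
  have hxK : ∀ᶠ n in atTop, x n ∈ K := by
    filter_upwards [eventually_ge_atTop N] with n hn
    by_contra hnK
    have hlt : f (x N) + 1 < f (x n) := hKf hnK
    have hdist := (enorm_sub_le_riemDist hf hfg (x N) (x n)).trans_lt (hN N le_rfl n hn)
    rw [Real.enorm_eq_ofReal_abs, ENNReal.ofReal_lt_one] at hdist
    linarith [(le_abs_self _).trans_lt hdist]
  obtain ⟨y, -, hy⟩ := hK.exists_mapClusterPt_of_frequently hxK.frequently
  refine ⟨y, ENNReal.tendsto_nhds_zero.2 fun ε hε ↦ ?_⟩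
  obtain ⟨N', hN'⟩ := hx (ε / 2) (ENNReal.half_pos hε.ne')
  obtain ⟨k, hky, hk⟩ := ((hy.frequently (eventually_riemDist_lt gR y
    (ENNReal.half_pos hε.ne'))).and_eventually (eventually_ge_atTop N')).exists
  filter_upwards [eventually_ge_atTop N'] with n hn
  calc riemDist gR (x n) y ≤ riemDist gR (x n) (x k) + riemDist gR (x k) y :=
        riemDist_triangle gR _ _ _
    _ ≤ ε / 2 + ε / 2 := add_le_add (hN' n hn k hk).le hky.le
    _ = ε := ENNReal.add_halves ε

end Distance

section CompleteMetric

variable {E : Type*} [NormedAddCommGroup E] [NormedSpace ℝ E]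
  {M : Type*} [TopologicalSpace M] [ChartedSpace E M] [IsManifold 𝓘(ℝ, E) ∞ M]

/-- The field of bilinear forms over the domain of the chart at `p` which is constantly equal to `B`
in the coordinates of this chart. -/
def constFormInChart (B : E →L[ℝ] E →L[ℝ] ℝ) (p x : M) :
    TangentSpace 𝓘(ℝ, E) x →L[ℝ] TangentSpace 𝓘(ℝ, E) x →L[ℝ] ℝ :=
  letI A : E →L[ℝ] E :=
    (trivializationAt E (TangentSpace 𝓘(ℝ, E)) p).continuousLinearMapAt ℝ x
  (B.bilinearComp A A : E →L[ℝ] E →L[ℝ] ℝ)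

lemma constFormInChart_apply (B : E →L[ℝ] E →L[ℝ] ℝ) (p x : M) (v w : TangentSpace 𝓘(ℝ, E) x) :
    constFormInChart B p x v w =
      B ((trivializationAt E (TangentSpace 𝓘(ℝ, E)) p).continuousLinearMapAt ℝ x v)
        ((trivializationAt E (TangentSpace 𝓘(ℝ, E)) p).continuousLinearMapAt ℝ x w) :=
  rfl

lemma contMDiffOn_constFormInChart (B : E →L[ℝ] E →L[ℝ] ℝ) (p : M) :
    ContMDiffOn 𝓘(ℝ, E) (𝓘(ℝ, E).prod 𝓘(ℝ, E →L[ℝ] E →L[ℝ] ℝ)) ∞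
      (fun x ↦ Bundle.TotalSpace.mk' (E →L[ℝ] E →L[ℝ] ℝ)
        (E := fun x : M ↦ TangentSpace 𝓘(ℝ, E) x →L[ℝ] TangentSpace 𝓘(ℝ, E) x →L[ℝ] ℝ) x
        (constFormInChart B p x))
      (trivializationAt E (TangentSpace 𝓘(ℝ, E)) p).baseSet := by
  rw [Bundle.Trivialization.contMDiffOn_section_iff
    (e := trivializationAt (E →L[ℝ] E →L[ℝ] ℝ)
      (fun x : M ↦ TangentSpace 𝓘(ℝ, E) x →L[ℝ] TangentSpace 𝓘(ℝ, E) x →L[ℝ] ℝ) p)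
    (trivializationAt E (TangentSpace 𝓘(ℝ, E)) p).open_baseSet
    (by simp [hom_trivializationAt_baseSet])]
  refine (contMDiffOn_const (c := B)).congr fun x hx ↦ ?_
  ext v w
  rw [hom_trivializationAt_apply]
  refine (inCoordinates_apply_eq₂ (E₁ := TangentSpace 𝓘(ℝ, E)) (E₂ := TangentSpace 𝓘(ℝ, E))
    (E₃ := Bundle.Trivial M ℝ) (ϕ := constFormInChart B p x) hx hx (by simp)).trans ?_
  have hsymm : ∀ u : E, (trivializationAt E (TangentSpace 𝓘(ℝ, E)) p).continuousLinearMapAt ℝ x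
      ((trivializationAt E (TangentSpace 𝓘(ℝ, E)) p).symm x u) = u := fun u ↦ by
    rw [← Bundle.Trivialization.symmL_apply (R := ℝ) _ hx,
      Bundle.Trivialization.continuousLinearMapAt_symmL _ hx]
  simp only [Bundle.Trivial.linearMapAt_trivialization,
    Bundle.Trivial.fiberBundle_trivializationAt', LinearMap.id_apply, constFormInChart_apply, hsymm]

lemma mvfderiv_eq_fderiv_comp_trivializationAt {f : M → ℝ} {p x : M}
    (hf : MDifferentiableAt 𝓘(ℝ, E) 𝓘(ℝ, ℝ) f x) (hx : x ∈ (extChartAt 𝓘(ℝ, E) p).source)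
    (v : TangentSpace 𝓘(ℝ, E) x) :
    mvfderiv 𝓘(ℝ, E) f x v =
      fderiv ℝ (f ∘ (extChartAt 𝓘(ℝ, E) p).symm) (extChartAt 𝓘(ℝ, E) p x)
        ((trivializationAt E (TangentSpace 𝓘(ℝ, E)) p).continuousLinearMapAt ℝ x v) := by
  have hF : MDifferentiableAt 𝓘(ℝ, E) 𝓘(ℝ, ℝ) (f ∘ (extChartAt 𝓘(ℝ, E) p).symm)
      (extChartAt 𝓘(ℝ, E) p x) :=
    hf.comp_of_eq _ ((contMDiffAt_extChartAt_symm
      ((extChartAt 𝓘(ℝ, E) p).map_source hx)).mdifferentiableAt (by simp))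
      ((extChartAt 𝓘(ℝ, E) p).left_inv hx)
  have hfF : f =ᶠ[𝓝 x] (f ∘ (extChartAt 𝓘(ℝ, E) p).symm) ∘ extChartAt 𝓘(ℝ, E) p := by
    filter_upwards [extChartAt_source_mem_nhds' hx] with y hy
    simp only [Function.comp_apply, (extChartAt 𝓘(ℝ, E) p).left_inv hy]
  rw [mvfderiv, hfF.mfderiv_eq, mfderiv_comp x hF
    ((contMDiffAt_extChartAt_of_mem_source hx).mdifferentiableAt (by simp)), mfderiv_eq_fderiv,
    TangentBundle.continuousLinearMapAt_trivializationAt (by simpa using hx)]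
  rfl

lemma exists_eventually_abs_mvfderiv_le {f : M → ℝ}
    (hf : ContMDiff 𝓘(ℝ, E) 𝓘(ℝ, ℝ) 1 f) (p : M) :
    ∃ K, ∀ᶠ x in 𝓝 p, ∀ v : TangentSpace 𝓘(ℝ, E) x, |mvfderiv 𝓘(ℝ, E) f x v| ≤
      K * ‖(trivializationAt E (TangentSpace 𝓘(ℝ, E)) p).continuousLinearMapAt ℝ x v‖ := by
  have hF : ContDiffAt ℝ 1 (f ∘ (extChartAt 𝓘(ℝ, E) p).symm) (extChartAt 𝓘(ℝ, E) p p) :=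
    ((hf _).comp _
      ((contMDiffAt_extChartAt_symm (mem_extChartAt_target p)).of_le (by simp))).contDiffAt
  have hbound := (((hF.fderiv_right (m := 0) le_rfl).continuousAt.norm.comp
    (continuousAt_extChartAt p)).eventually_lt_const (lt_add_one _))
  refine ⟨‖fderiv ℝ (f ∘ (extChartAt 𝓘(ℝ, E) p).symm) (extChartAt 𝓘(ℝ, E) p p)‖ + 1, ?_⟩
  filter_upwards [hbound, extChartAt_source_mem_nhds (I := 𝓘(ℝ, E)) p]
    with x hx hxs v
  rw [mvfderiv_eq_fderiv_comp_trivializationAt ((hf x).mdifferentiableAt one_ne_zero) hxs]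
  exact ContinuousLinearMap.le_of_opNorm_le _ hx.le _

variable [FiniteDimensional ℝ E]

variable (E) in
lemma exists_symm_forall_mul_norm_sq_le {K : ℝ} (hK : 0 ≤ K) :
    ∃ B : E →L[ℝ] E →L[ℝ] ℝ, (∀ v w, B v w = B w v) ∧ ∀ v, K * ‖v‖ ^ 2 ≤ B v v := by
  let A : E →L[ℝ] EuclideanSpace ℝ (Fin (Module.finrank ℝ E)) := (toEuclidean (E := E) : E →L[ℝ] _)
  let L : EuclideanSpace ℝ (Fin (Module.finrank ℝ E)) →L[ℝ] E := (toEuclidean (E := E)).symm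
  refine ⟨(K * ‖L‖ ^ 2) • (innerSL ℝ).bilinearComp A A,
    fun v w ↦ congrArg (K * ‖L‖ ^ 2 * ·) (real_inner_comm (A w) (A v)), fun v ↦ ?_⟩
  have hv : ‖v‖ ≤ ‖L‖ * ‖A v‖ := by simpa [A, L] using L.le_opNorm (A v)
  calc K * ‖v‖ ^ 2 ≤ K * (‖L‖ * ‖A v‖) ^ 2 := by gcongr
    _ = K * ‖L‖ ^ 2 * inner ℝ (A v) (A v) := by rw [real_inner_self_eq_norm_sq]; ring

/-- Adding a multiple of the norm makes the domination strict away from `0`, so that the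
dominating forms are positive definite. -/
lemma exists_constFormInChart_dominates {f : M → ℝ}
    (hf : ContMDiff 𝓘(ℝ, E) 𝓘(ℝ, ℝ) 1 f) (p : M) :
    ∃ B : E →L[ℝ] E →L[ℝ] ℝ, (∀ v w, B v w = B w v) ∧
      ∀ᶠ x in 𝓝 p, ∀ v : TangentSpace 𝓘(ℝ, E) x, v ≠ 0 →
        mvfderiv 𝓘(ℝ, E) f x v ^ 2 < constFormInChart B p x v v := by
  obtain ⟨K, hK⟩ := exists_eventually_abs_mvfderiv_le hf p
  obtain ⟨B, hB_symm, hB⟩ := exists_symm_forall_mul_norm_sq_le E (K := K ^ 2 + 1) (by positivity)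
  refine ⟨B, hB_symm, ?_⟩
  filter_upwards [hK, chart_source_mem_nhds E p] with x hx hxs v hv
  set A := (trivializationAt E (TangentSpace 𝓘(ℝ, E)) p).continuousLinearMapAt ℝ x
  have hAv : A v ≠ 0 := fun h ↦ hv <| by
    rw [← (trivializationAt E (TangentSpace 𝓘(ℝ, E)) p).symmL_continuousLinearMapAt (R := ℝ) hxs v,
      h, map_zero]
  calc mvfderiv 𝓘(ℝ, E) f x v ^ 2 ≤ (K * ‖A v‖) ^ 2 :=
        sq_le_sq' (abs_le.1 (hx v)).1 (abs_le.1 (hx v)).2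
    _ < (K ^ 2 + 1) * ‖A v‖ ^ 2 := by
        have := pow_pos (norm_pos_iff.2 hAv) 2
        linarith
    _ ≤ B (A v) (A v) := hB _

lemma isVonNBounded_of_pos (B : E →L[ℝ] E →L[ℝ] ℝ) (hB : ∀ v, v ≠ 0 → 0 < B v v) :
    Bornology.IsVonNBounded ℝ {v : E | B v v < 1} := by
  have := FiniteDimensional.proper ℝ E
  obtain ⟨r, hr, hrB⟩ := (isCompact_sphere (0 : E) 1).exists_forall_le'
    (f := fun v ↦ B v v) (a := 0)
    (by fun_prop) (fun v hv ↦ hB v (by rintro rfl; simp at hv))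
  refine (NormedSpace.isVonNBounded_closedBall ℝ E (√(1 / r))).subset fun v (hv : B v v < 1) ↦ ?_
  rw [mem_closedBall_zero_iff]
  rcases eq_or_ne v 0 with rfl | hv0
  · simp
  have hv_pos := norm_pos_iff.2 hv0
  have hB_normalize := hrB (‖v‖⁻¹ • v) (by simp [norm_smul, hv_pos.ne'])
  simp only [map_smul, smul_apply, smul_eq_mul] at hB_normalize
  refine Real.le_sqrt_of_sq_le ((le_div_iff₀ hr).2 ?_)
  calc ‖v‖ ^ 2 * r ≤ ‖v‖ ^ 2 * (‖v‖⁻¹ * (‖v‖⁻¹ * B v v)) := by gcongr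
    _ = B v v := by field_simp
    _ ≤ 1 := hv.le

lemma exists_riemMetric_sq_mvfderiv_le [T2Space M] [SigmaCompactSpace M] {f : M → ℝ}
    (hf : ContMDiff 𝓘(ℝ, E) 𝓘(ℝ, ℝ) 1 f) :
    ∃ gR : RiemMetric E M, ∀ x v, mvfderiv 𝓘(ℝ, E) f x v ^ 2 ≤ gR.inner x v v := by
  obtain ⟨B, hB⟩ := exists_contMDiffSection_forall_mem_convex_of_local (n := ⊤) 𝓘(ℝ, E)
    (F_fiber := E →L[ℝ] E →L[ℝ] ℝ)
    (fun x : M ↦ TangentSpace 𝓘(ℝ, E) x →L[ℝ] TangentSpace 𝓘(ℝ, E) x →L[ℝ] ℝ)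
    (fun x ↦ {B | (∀ v w, B v w = B w v) ∧ ∀ v, v ≠ 0 → mvfderiv 𝓘(ℝ, E) f x v ^ 2 < B v v})
    (fun x B hB B' hB' a a' ha ha' haa' ↦ by
      refine ⟨fun v w ↦ ?_, fun v hv ↦ ?_⟩
      · change a * B v w + a' * B' v w = a * B w v + a' * B' w v
        rw [hB.1, hB'.1]
      · exact convex_Ioi (𝕜 := ℝ) _ (mem_Ioi.2 (hB.2 v hv)) (mem_Ioi.2 (hB'.2 v hv)) ha ha' haa')
    (fun p ↦ by
      obtain ⟨B, hB_symm, hB⟩ := exists_constFormInChart_dominates hf p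
      exact ⟨_, inter_mem ((trivializationAt E (TangentSpace 𝓘(ℝ, E)) p).open_baseSet.mem_nhds
        (mem_chart_source E p)) hB, constFormInChart B p,
        (contMDiffOn_constFormInChart B p).mono inter_subset_left,
        fun x hx ↦ ⟨fun v w ↦ hB_symm _ _, hx.2⟩⟩)
  have hpos : ∀ (x : M) (v : TangentSpace 𝓘(ℝ, E) x), v ≠ 0 → 0 < B x v v := fun x v hv ↦
    (sq_nonneg _).trans_lt ((hB x).2 v hv)
  refine ⟨⟨fun x ↦ B x, fun x ↦ (hB x).1, hpos,
    fun x ↦ isVonNBounded_of_pos (E := E) (B x) (hpos x),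
    B.contMDiff⟩, fun x v ↦ ?_⟩
  rcases eq_or_ne v 0 with rfl | hv
  · simp only [map_zero, ne_eq, OfNat.ofNat_ne_zero, not_false_eq_true, zero_pow, le_refl]
  · exact ((hB x).2 v hv).le

variable (E) in
lemma exists_contMDiff_tendsto_cocompact [T2Space M] [SigmaCompactSpace M] :
    ∃ f : M → ℝ, ContMDiff 𝓘(ℝ, E) 𝓘(ℝ, ℝ) ∞ f ∧ Tendsto f (cocompact M) atTop := by
  have := FiniteDimensional.proper ℝ E
  have : LocallyCompactSpace M := ChartedSpace.locallyCompactSpace E M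
  let K := CompactExhaustion.choice M
  obtain ⟨f, hf⟩ := exists_contMDiffMap_forall_mem_convex_of_local_const (n := ⊤) 𝓘(ℝ, E)
    (t := fun x : M ↦ Ici (K.find x : ℝ)) (fun x ↦ convex_Ici _) (fun x ↦ by
      refine ⟨(K.find x + 1 : ℕ), ?_⟩
      filter_upwards [isOpen_interior.mem_nhds (K.subset_interior_succ _ (K.mem_find x))] with y hy
      exact (Nat.cast_le (α := ℝ)).2 (K.mem_iff_find_le.1 (interior_subset hy)))
  refine ⟨f, f.contMDiff, tendsto_atTop.2 fun c ↦
    mem_cocompact.2 ⟨K ⌈c⌉₊, K.isCompact _, fun x hx ↦ ?_⟩⟩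
  rw [mem_compl_iff, K.mem_iff_find_le, not_le] at hx
  calc c ≤ ⌈c⌉₊ := Nat.le_ceil c
    _ ≤ K.find x := by exact_mod_cast hx.le
    _ ≤ f x := hf x

variable (E M) in
theorem exists_isCompleteMetric [T2Space M] [SigmaCompactSpace M] :
    ∃ gR : RiemMetric E M, IsCompleteMetric gR := by
  obtain ⟨f, hf, hf_proper⟩ := exists_contMDiff_tendsto_cocompact E (M := M)
  obtain ⟨gR, hgR⟩ := exists_riemMetric_sq_mvfderiv_le (hf.of_le (m := 1) (by simp))
  exact ⟨gR, isCompleteMetric_of_tendsto_cocompact (hf.of_le (by simp)) hf_proper hgR⟩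

end CompleteMetric

section VelocityCurve

variable {E : Type*} [NormedAddCommGroup E] [NormedSpace ℝ E]
  {M : Type*} [TopologicalSpace M] [ChartedSpace E M]

lemma velocity_eq_of_eqOn {γ σ : ℝ → M} {s s' : Set ℝ} (h : EqOn σ γ s) {t : ℝ} (ht : t ∈ s)
    (hs : s =ᶠ[𝓝 t] s') :
    (⟨σ t, velocity σ s' t⟩ : TangentBundle 𝓘(ℝ, E) M) = ⟨γ t, velocity γ s t⟩ := by
  rw [velocity, ← mfderivWithin_congr_set hs]
  exact tangentMapWithin_congr h (⟨t, (1 : ℝ)⟩ : TangentBundle 𝓘(ℝ, ℝ) ℝ) ht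

variable [IsManifold 𝓘(ℝ, E) ∞ M]

lemma continuousOn_velocity {σ : ℝ → M} {s : Set ℝ} (hs : UniqueDiffOn ℝ s)
    (hσ : ContMDiffOn 𝓘(ℝ, ℝ) 𝓘(ℝ, E) 1 σ s) :
    ContinuousOn (fun t ↦ (⟨σ t, velocity σ s t⟩ : TangentBundle 𝓘(ℝ, E) M)) s := by
  have hunit : Continuous (fun t : ℝ ↦ (⟨t, (1 : ℝ)⟩ : TangentBundle 𝓘(ℝ, ℝ) ℝ)) :=
    (tangentBundleModelSpaceHomeomorph 𝓘(ℝ, ℝ)).symm.continuous.comp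
      (Continuous.prodMk continuous_id continuous_const : Continuous fun t : ℝ ↦ (t, (1 : ℝ)))
  exact (hσ.continuousOn_tangentMapWithin le_rfl hs.uniqueMDiffOn).comp hunit.continuousOn
    fun t ht ↦ ht

lemma continuous_sqrt_inner_self (gR : RiemMetric E M) :
    Continuous fun v : TangentBundle 𝓘(ℝ, E) M ↦ √(gR.inner v.1 v.2 v.2) := by
  let : Bundle.RiemannianBundle (fun x : M ↦ TangentSpace 𝓘(ℝ, E) x) := ⟨gR.toRiemannianMetric⟩
  have := isContinuousRiemannianBundle gR
  exact (Continuous.inner_bundle (F := E) (E := fun x : M ↦ TangentSpace 𝓘(ℝ, E) x)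
    (b := fun v : TangentBundle 𝓘(ℝ, E) M ↦ v.1) (v := fun v ↦ v.2) (w := fun v ↦ v.2)
    continuous_id continuous_id).sqrt

variable {g : Metric E M} {γ : ℝ → M} {b : ℝ}

lemma Metric.IsExtendibleBeyond.exists_continuousOn_eqOn_velocity (h : g.IsExtendibleBeyond γ b) :
    ∃ V : ℝ → TangentBundle 𝓘(ℝ, E) M, ContinuousOn V (Icc 0 b) ∧
      EqOn V (fun t ↦ ⟨γ t, velocity γ (Ico 0 b) t⟩) (Ico 0 b) := by
  obtain ⟨b', hbb', σ, hσ, hσγ⟩ := h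
  refine ⟨fun t ↦ ⟨σ t, velocity σ (Ico 0 b') t⟩,
    (continuousOn_velocity (uniqueDiffOn_Ico _ _) (hσ.1.of_le (by simp))).mono
      (Icc_subset_Ico_right hbb'), fun t ht ↦ ?_⟩
  exact velocity_eq_of_eqOn hσγ ht (Ico_eventuallyEq_Ico_of_lt ht.2 (ht.2.trans hbb'))

theorem Metric.IsExtendibleBeyond.boundedSpeedOn (h : g.IsExtendibleBeyond γ b)
    (gR : RiemMetric E M) : BoundedSpeedOn gR γ (Ico 0 b) := by
  obtain ⟨V, hV, hVγ⟩ := h.exists_continuousOn_eqOn_velocity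
  obtain ⟨C, hC⟩ := (isCompact_Icc.image_of_continuousOn
    ((continuous_sqrt_inner_self gR).comp_continuousOn hV)).bddAbove
  refine ⟨C, fun t ht ↦ ?_⟩
  exact (congrArg (fun v : TangentBundle 𝓘(ℝ, E) M ↦ √(gR.inner v.1 v.2 v.2))
    (hVγ ht)).symm.trans_le
    (hC (mem_image_of_mem _ (Ico_subset_Icc_self ht)))

theorem Metric.IsExtendibleBeyond.exists_tendsto_velocity (h : g.IsExtendibleBeyond γ b)
    (hb : 0 ≤ b) : ∃ v : TangentBundle 𝓘(ℝ, E) M,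
      Tendsto (fun t ↦ (⟨γ t, velocity γ (Ico 0 b) t⟩ : TangentBundle 𝓘(ℝ, E) M))
        (𝓝[Ico 0 b] b) (𝓝 v) := by
  obtain ⟨V, hV, hVγ⟩ := h.exists_continuousOn_eqOn_velocity
  exact ⟨V b, ((hV b (right_mem_Icc.2 hb)).mono Ico_subset_Icc_self).congr'
    (eventually_mem_nhdsWithin.mono hVγ)⟩

end VelocityCurve

section BoundedSpeed

variable {E : Type*} [NormedAddCommGroup E] [NormedSpace ℝ E]
  {M : Type*} [TopologicalSpace M] [ChartedSpace E M] [IsManifold 𝓘(ℝ, E) ∞ M]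
  {gR : RiemMetric E M} {γ : ℝ → M} {a b C : ℝ}

lemma riemDist_le_of_speed_le (hγ : ContMDiffOn 𝓘(ℝ, ℝ) 𝓘(ℝ, E) 1 γ (Ico a b))
    (hC : ∀ t ∈ Ico a b, √(gR.inner (γ t) (velocity γ (Ico a b) t) (velocity γ (Ico a b) t)) ≤ C)
    {s t : ℝ} (hs : s ∈ Ico a b) (ht : t ∈ Ico a b) :
    riemDist gR (γ s) (γ t) ≤ ENNReal.ofReal C * edist s t := by
  wlog hst : s ≤ t generalizing s t
  · rw [riemDist_comm, edist_comm]
    exact this ht hs (le_of_not_ge hst)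
  let : Bundle.RiemannianBundle (fun x : M ↦ TangentSpace 𝓘(ℝ, E) x) := ⟨gR.toRiemannianMetric⟩
  calc riemDist gR (γ s) (γ t) ≤ Manifold.pathELength 𝓘(ℝ, E) γ s t :=
        Manifold.riemannianEDist_le_pathELength
          (hγ.mono fun u hu ↦ ⟨hs.1.trans hu.1, hu.2.trans_lt ht.2⟩) rfl rfl hst
    _ = ∫⁻ u in Ioo s t, ‖mfderiv 𝓘(ℝ, ℝ) 𝓘(ℝ, E) γ u (1 : ℝ)‖ₑ :=
        Manifold.pathELength_eq_lintegral_mfderiv_Ioo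
    _ ≤ ∫⁻ _ in Ioo s t, ENNReal.ofReal C := by
        refine MeasureTheory.setLIntegral_mono' measurableSet_Ioo fun u hu ↦ ?_
        rw [enorm_eq_ofReal_sqrt_inner, ← mfderivWithin_of_mem_nhds
          (Ico_mem_nhds (hs.1.trans_lt hu.1) (hu.2.trans ht.2))]
        exact ENNReal.ofReal_le_ofReal (hC u ⟨hs.1.trans hu.1.le, hu.2.trans ht.2⟩)
    _ = ENNReal.ofReal C * edist s t := by
        rw [MeasureTheory.setLIntegral_const, Real.volume_Ioo, edist_comm, edist_dist, Real.dist_eq,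
          abs_of_nonneg (sub_nonneg.2 hst)]

lemma IsCompleteMetric.exists_tendsto_of_speed_le [RegularSpace M] (hgR : IsCompleteMetric gR)
    (hγ : ContMDiffOn 𝓘(ℝ, ℝ) 𝓘(ℝ, E) 1 γ (Ico a b))
    (hC : ∀ t ∈ Ico a b, √(gR.inner (γ t) (velocity γ (Ico a b) t) (velocity γ (Ico a b) t)) ≤ C)
    {s : ℕ → ℝ} (hs : ∀ n, s n ∈ Ico a b) (hs_cauchy : CauchySeq s) :
    ∃ y, Tendsto (fun n ↦ γ (s n)) atTop (𝓝 y) := by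
  obtain ⟨y, hy⟩ := hgR (fun n ↦ γ (s n)) fun ε hε ↦ by
    obtain ⟨N, hN⟩ := EMetric.cauchySeq_iff.1 hs_cauchy (ε / ENNReal.ofReal C)
      (ENNReal.div_pos hε.ne' ENNReal.ofReal_ne_top)
    exact ⟨N, fun m hm n hn ↦ (riemDist_le_of_speed_le hγ hC (hs m) (hs n)).trans_lt
      (ENNReal.mul_lt_of_lt_div' (hN m hm n hn))⟩
  exact ⟨y, tendsto_of_tendsto_riemDist hy⟩

variable (gR) in
lemma exists_eventually_norm_trivializationAt_le (y : M) :
    ∃ K ≥ 0, ∀ᶠ x in 𝓝 y, ∀ v : TangentSpace 𝓘(ℝ, E) x,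
      ‖(trivializationAt E (TangentSpace 𝓘(ℝ, E)) y ⟨x, v⟩).2‖ ≤ K * √(gR.inner x v v) := by
  let : Bundle.RiemannianBundle (fun x : M ↦ TangentSpace 𝓘(ℝ, E) x) := ⟨gR.toRiemannianMetric⟩
  have := isContinuousRiemannianBundle gR
  obtain ⟨K, hK, hK_bound⟩ := eventually_norm_trivializationAt_lt E
    (fun x : M ↦ TangentSpace 𝓘(ℝ, E) x) y
  refine ⟨K, hK.le, ?_⟩
  filter_upwards [hK_bound, chart_source_mem_nhds E y] with x hx hxy v
  rw [← norm_eq_sqrt_inner]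
  have hle := ContinuousLinearMap.le_of_opNorm_le _ hx.le v
  rwa [Bundle.Trivialization.continuousLinearMapAt_apply, Bundle.Trivialization.linearMapAt_apply,
    if_pos (by simpa using hxy)] at hle

theorem Metric.IsGeodesicOn.isExtendibleBeyond_of_boundedSpeedOn [FiniteDimensional ℝ E]
    [T2Space M] {g : Metric E M} (hb : 0 < b) (hγ : g.IsGeodesicOn γ (Ico 0 b))
    (hgR : IsCompleteMetric gR) (h : BoundedSpeedOn gR γ (Ico 0 b)) :
    g.IsExtendibleBeyond γ b := by
  have := FiniteDimensional.proper ℝ E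
  have : LocallyCompactSpace M := ChartedSpace.locallyCompactSpace E M
  obtain ⟨C, hC⟩ := h
  obtain ⟨s, -, hs, hsb⟩ := exists_seq_strictMono_tendsto' hb
  have hs' : ∀ n, s n ∈ Ico 0 b := fun n ↦ Ioo_subset_Ico_self (hs n)
  obtain ⟨y, hy⟩ :=
    hgR.exists_tendsto_of_speed_le (hγ.1.of_le (by simp)) hC hs' hsb.cauchySeq
  obtain ⟨K, hK, hK_bound⟩ := exists_eventually_norm_trivializationAt_le gR y
  have hy_source := hy.eventually_mem (extChartAt_source_mem_nhds (I := 𝓘(ℝ, E)) y)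
  have hbound : ∀ᶠ n in atTop, (chartLift y γ (s n)).2 ∈ Metric.closedBall (0 : E) (K * C) := by
    filter_upwards [hy.eventually hK_bound, hy_source] with n hn hn_source
    have hsn := Ico_mem_nhds (hs n).1 (hs n).2
    rw [mem_closedBall_zero_iff, chartLift_eq_tangentChart_velocity hsn
      ((hγ.1.contMDiffAt hsn).mdifferentiableAt (by simp)) hn_source]
    exact (hn _).trans (mul_le_mul_of_nonneg_left (hC _ (hs' n)) hK)
  obtain ⟨w, -, φ, hφ, hw⟩ := (isCompact_closedBall (0 : E) (K * C)).tendsto_subseq'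
    hbound.frequently
  exact hγ.isExtendibleBeyond_of_tendsto_chartLift (s := s ∘ φ) (mem_extChartAt_target y)
    (.of_forall fun n ↦ hs _) (hsb.comp hφ.tendsto_atTop)
    (hφ.tendsto_atTop.eventually hy_source)
    ((((continuousAt_extChartAt y).tendsto.comp hy).comp hφ.tendsto_atTop).prodMk_nhds hw)

end BoundedSpeed

end SemiRiemannian

end

theorem mainTheorem4
    {E : Type*} [NormedAddCommGroup E] [NormedSpace ℝ E] [FiniteDimensional ℝ E]
    {M : Type*} [TopologicalSpace M] [T2Space M] [ConnectedSpace M]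
    [ChartedSpace E M] [IsManifold 𝓘(ℝ, E) ∞ M]
    (g : SemiRiemannian.Metric E M) (γ : ℝ → M) (b : ℝ) (hb : 0 < b)
    (hγ : g.IsGeodesicOn γ (Set.Ico 0 b)) :
    List.TFAE [
      g.IsExtendibleBeyond γ b,
      ∃ gR : SemiRiemannian.RiemMetric E M, SemiRiemannian.IsCompleteMetric gR ∧
        SemiRiemannian.BoundedSpeedOn gR γ (Set.Ico 0 b),
      ∀ gR : SemiRiemannian.RiemMetric E M, SemiRiemannian.IsCompleteMetric gR →
        SemiRiemannian.BoundedSpeedOn gR γ (Set.Ico 0 b),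
      ∃ (s : ℕ → ℝ) (v : TangentBundle 𝓘(ℝ, E) M),
        StrictMono s ∧ (∀ n, s n ∈ Set.Ico 0 b) ∧ Filter.Tendsto s Filter.atTop (𝓝 b) ∧
        Filter.Tendsto
          (fun n ↦ (⟨γ (s n), SemiRiemannian.velocity γ (Set.Ico 0 b) (s n)⟩ :
            TangentBundle 𝓘(ℝ, E) M))
          Filter.atTop (𝓝 v)] := by
  have := FiniteDimensional.proper ℝ E
  have : LocallyCompactSpace M := ChartedSpace.locallyCompactSpace E M
  have := g.secondCountableTopology
  tfae_have 1 → 3 := fun h gR _ ↦ h.boundedSpeedOn gR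
  tfae_have 3 → 2 := fun h ↦
    have ⟨gR, hgR⟩ := SemiRiemannian.exists_isCompleteMetric E M
    ⟨gR, hgR, h gR hgR⟩
  tfae_have 2 → 1 := fun ⟨_, hgR, h⟩ ↦ hγ.isExtendibleBeyond_of_boundedSpeedOn hb hgR h
  tfae_have 1 → 4 := fun h ↦ by
    obtain ⟨v, hv⟩ := h.exists_tendsto_velocity hb.le
    obtain ⟨s, hs_mono, hs, hsb⟩ := exists_seq_strictMono_tendsto' hb
    have hs' := fun n ↦ Set.Ioo_subset_Ico_self (hs n)
    exact ⟨s, v, hs_mono, hs', hsb,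
      hv.comp (tendsto_nhdsWithin_iff.2 ⟨hsb, .of_forall hs'⟩)⟩
  tfae_have 4 → 1 := by
    rintro ⟨s, v, hs_mono, hs, hsb, hv⟩
    refine hγ.isExtendibleBeyond_of_tendsto_velocity ?_ hsb hv
    filter_upwards [Filter.eventually_gt_atTop 0] with n hn
    exact ⟨(hs 0).1.trans_lt (hs_mono hn), (hs n).2⟩
  tfae_finish
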